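/- Let $V$ be a finite set and $P=(P_{x,y})_{x,y\in V}$ an irreducible, strictly sub-stochastic kernel: $P_{x,y}\ge 0$, $\sum_{y}P_{x,y}\le 1$ for all $x$, with strict inequality for at least one $x$, and for all $x,y$ there is an integer $\ell\ge 0$ with $(P^\ell)_{x,y}>0$. Let $\lambda_x\ge 0$, $\sigma_x\in[0,1]$ and $\nu_x\ge 0$ for $x\in V$, and assume $\sigma_x\le \frac{\lambda_x}{1+\lambda_x}$ for all $x\in V$. For each positive integer $n$ consider the following continuous-time Markov process (activated random walk) on particle configurations on the set of houses $V\times\{1,\dots,n\}$; the house $(x,i)$ belongs to village $x$. Each particle is active or sleepy, and only a particle that is alone in its house can be sleepy. Initially, for each $x\in V$, a set of $\lfloor\sigma_x n\rfloor$ (arbitrarily chosen) houses of village $x$ contains one sleepy particle each, and $\lfloor\nu_x n\rfloor$ active particles are added to village $x$, in independent and uniformly chosen houses of village $x$. Each active particle in a house of village $x$ jumps out of the system at rate $1-\sum_{y}P_{x,y}$, and jumps to the house $(y,j)$ at rate $\frac1n P_{x,y}$, for each $y \in V$ and $1\le j\le n$. An active particle that is alone in its house in village $x$ falls asleep at rate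 $\lambda_x$. Sleepy particles do not move; a sleepy particle becomes active as soon as another particle arrives in its house (initially or by a jump). Then for every $n$ the process almost surely terminates in a stable configuration (one with no active particles). Let $S^{(n)}_*(x)$ be the number of sleepy particles in village $x$ in that configuration and $M^{(n)}_*(x)$ the total number of jumps made by particles from houses of village $x$. The system of equations $$s_x=-m_x+\sigma_x+\nu_x+\sum_{y}m_yP_{y,x},\qquad x\in V,$$ $$s_x=\sigma_x e^{-(\nu_x+\sum_y m_yP_{y,x})}+\frac{\lambda_x}{1+\lambda_x}\Bigl(1-e^{-(\nu_x+\sum_y m_yP_{y,x})}\Bigr),\qquad x\in V,$$ has a unique solution $(s_*,m_*)\in[0,1]^V\times[0,\infty)^V$, and the random vectors $\frac1n S^{(n)}_*$ and $\frac1n M^{(n)}_*$ converge in probability to $s_*$ and $m_*$, respectively, as $n\to\infty$. -/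

import Mathlib

open MeasureTheory ProbabilityTheory Filter Topology
open scoped ENNReal NNReal

/-! ### Configurations of the village model -/

namespace VARW

/-- The state of one house: it either holds exactly one particle, which is sleepy, or it holds
`k ≥ 0` particles, all of them active (`active 0` is the empty house). -/
inductive HouseState
  | sleepy : HouseState
  | active (k : ℕ) : HouseState
  deriving DecidableEq

namespace HouseState

/-- Number of active particles in a house. -/
def numActive : HouseState → ℕ
  | sleepy => 0
  | active k => k

/-- An active particle lands in the house; a sleepy particle there wakes up. -/
def land : HouseState → HouseState
  | sleepy => active 2
  | active k => active (k + 1)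

/-- An active particle leaves the house (only used when there is one). -/
def leave : HouseState → HouseState
  | sleepy => sleepy
  | active k => active (k - 1)

end HouseState

/-- The houses `(x, i)`: village `x ∈ V`, house number `i` out of `n`. -/
abbrev House (V : Type*) (n : ℕ) : Type _ := V × Fin n

/-- A particle configuration. -/
abbrev Config (V : Type*) (n : ℕ) : Type _ := House V n → HouseState

/-- A configuration is stable if it has no active particle. -/
def Config.Stable {V : Type*} {n : ℕ} (η : Config V n) : Prop :=
  ∀ h, (η h).numActive = 0

/-- The state of the process: the current configuration, together with the number of jumps made
so far from the houses of each village. -/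
@[ext]
structure State (V : Type*) (n : ℕ) where
  config : Config V n
  odometer : V → ℕ

/-- The state space is countable when `V` is finite; it carries the discrete `σ`-algebra. -/
instance {V : Type*} {n : ℕ} : MeasurableSpace (State V n) := ⊤

section Dynamics

variable {V : Type*} [Fintype V] [DecidableEq V]

namespace State

variable {n : ℕ}

/-- A particle jumps from house `h` to house `h'` (possibly `h' = h`). -/
def jump (z : State V n) (h h' : House V n) : State V n where
  config :=
    let η := Function.update z.config h (z.config h).leave
    Function.update η h' (η h').land
  odometer := Function.update z.odometer h.1 (z.odometer h.1 + 1)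

/-- A particle jumps from house `h` out of the system. -/
def exit (z : State V n) (h : House V n) : State V n where
  config := Function.update z.config h (z.config h).leave
  odometer := Function.update z.odometer h.1 (z.odometer h.1 + 1)

/-- The lonely particle of house `h` falls asleep. -/
def sleep (z : State V n) (h : House V n) : State V n where
  config := Function.update z.config h HouseState.sleepy
  odometer := z.odometer

end State

/-! ### The continuous-time Markov chain -/

/-- The transition rates out of the state `z`, as a measure on the state space. For each house
`h = (x, i)` with `a` active particles: rate `a * P x y / n` for a jump to each house of each
village `y`, rate `a * (1 - ∑ y, P x y)` for a jump out of the system, and, if `a = 1`, rate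
`lam x` for falling asleep. -/
noncomputable def rates (P : Matrix V V ℝ) (lam : V → ℝ) (n : ℕ) (z : State V n) :
    Measure (State V n) :=
  ∑ h : House V n,
    ((∑ h' : House V n,
        ENNReal.ofReal ((z.config h).numActive * (P h.1 h'.1 / n)) • Measure.dirac (z.jump h h'))
      + ENNReal.ofReal ((z.config h).numActive * (1 - ∑ y, P h.1 y)) • Measure.dirac (z.exit h)
      + (if (z.config h).numActive = 1 then ENNReal.ofReal (lam h.1) else 0) •
          Measure.dirac (z.sleep h))

/-- The total rate at which the process leaves the state `z`. -/
noncomputable def exitRate (P : Matrix V V ℝ) (lam : V → ℝ) (n : ℕ) (z : State V n) : ℝ≥0∞ :=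
  rates P lam n z Set.univ

theorem exitRate_ne_top (P : Matrix V V ℝ) (lam : V → ℝ) (n : ℕ) (z : State V n) :
    exitRate P lam n z ≠ ∞ := by
  unfold exitRate rates
  simp only [Measure.coe_finsetSum, Finset.sum_apply, Measure.coe_add, Pi.add_apply,
    Measure.smul_apply, measure_univ, smul_eq_mul, mul_one]
  refine ENNReal.sum_ne_top.2 fun h _ => ?_
  refine ENNReal.add_ne_top.2 ⟨ENNReal.add_ne_top.2 ⟨ENNReal.sum_ne_top.2 fun h' _ => ?_, ?_⟩, ?_⟩
  · exact ENNReal.ofReal_ne_top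
  · exact ENNReal.ofReal_ne_top
  · split_ifs
    · exact ENNReal.ofReal_ne_top
    · exact ENNReal.zero_ne_top

/-- Law of the state after the next transition from `z`; states with exit rate `0` are
absorbing. -/
noncomputable def nextLaw (P : Matrix V V ℝ) (lam : V → ℝ) (n : ℕ) (z : State V n) :
    Measure (State V n) :=
  open Classical in
  if exitRate P lam n z = 0 then Measure.dirac z
  else (exitRate P lam n z)⁻¹ • rates P lam n z

/-- The transition kernel of the embedded jump chain. -/
noncomputable def stepKernel (P : Matrix V V ℝ) (lam : V → ℝ) (n : ℕ) :
    Kernel (State V n) (State V n) where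
  toFun := nextLaw P lam n
  measurable' := measurable_from_top

instance (P : Matrix V V ℝ) (lam : V → ℝ) (n : ℕ) : IsMarkovKernel (stepKernel P lam n) := by
  refine ⟨fun z => ?_⟩
  change IsProbabilityMeasure (nextLaw P lam n z)
  unfold nextLaw
  split_ifs with h
  · infer_instance
  · refine ⟨?_⟩
    change (exitRate P lam n z)⁻¹ * exitRate P lam n z = 1
    exact ENNReal.inv_mul_cancel h (exitRate_ne_top P lam n z)

/-- The step kernel, as a kernel from histories of length `k`: it only looks at the present. -/
noncomputable def historyKernel (P : Matrix V V ℝ) (lam : V → ℝ) (n k : ℕ) :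
    Kernel (Finset.Iic k → State V n) (State V n) :=
  (stepKernel P lam n).comap (fun hist => hist ⟨k, Finset.mem_Iic.2 le_rfl⟩)
    (measurable_pi_apply _)

instance (P : Matrix V V ℝ) (lam : V → ℝ) (n k : ℕ) :
    IsMarkovKernel (historyKernel P lam n k) := by
  unfold historyKernel
  infer_instance

/-- The initial state: one sleepy particle in each house of `D`, to which `N x` active particles
are added in each village `x`, the `j`-th of them in the house `arr x j`; no jump has been made. -/
def initialState {n : ℕ} (D : V → Finset (Fin n)) (N : V → ℕ)
    (arr : (x : V) → Fin (N x) → Fin n) : State V n where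
  config := fun h =>
    HouseState.land^[Fintype.card {j : Fin (N h.1) // arr h.1 j = h.2}]
      (if h.2 ∈ D h.1 then HouseState.sleepy else HouseState.active 0)
  odometer := fun _ => 0

/-- The law of the initial state: the houses of the `⌊ν x * n⌋` active particles added to each
village `x` are independent and uniform (equivalently, all choices are equally likely). -/
noncomputable def initialLaw (ν : V → ℝ) (n : ℕ+) (D : V → Finset (Fin n)) :
    Measure (State V n) :=
  (PMF.uniformOfFintype ((x : V) → Fin ⌊ν x * n⌋₊ → Fin n)).toMeasure.map
    (initialState D fun x => ⌊ν x * n⌋₊)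

instance (ν : V → ℝ) (n : ℕ+) (D : V → Finset (Fin n)) :
    IsProbabilityMeasure (initialLaw ν n D) :=
  Measure.isProbabilityMeasure_map (measurable_of_finite _).aemeasurable

/-- The law of the embedded jump chain. -/
noncomputable def chainLaw (P : Matrix V V ℝ) (lam ν : V → ℝ) (n : ℕ+)
    (D : V → Finset (Fin n)) : Measure (ℕ → State V n) :=
  Kernel.trajMeasure (X := fun _ => State V n) (initialLaw ν n D) (historyKernel P lam n)

instance : IsProbabilityMeasure (expMeasure 1) := isProbabilityMeasure_expMeasure one_pos

/-- The probability measure of the model: the jump chain, and an independent i.i.d. sequence of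
exponential variables of rate `1`, which will be scaled to give the holding times. -/
noncomputable def law (P : Matrix V V ℝ) (lam ν : V → ℝ) (n : ℕ+) (D : V → Finset (Fin n)) :
    Measure ((ℕ → State V n) × (ℕ → ℝ)) :=
  (chainLaw P lam ν n D).prod (Measure.infinitePi fun _ : ℕ => expMeasure 1)

instance (P : Matrix V V ℝ) (lam ν : V → ℝ) (n : ℕ+) (D : V → Finset (Fin n)) :
    IsProbabilityMeasure (law P lam ν n D) := by
  unfold law chainLaw
  infer_instance

/-- The time of the `k`-th transition. The holding time in a state of exit rate `q` is
exponential of rate `q` (infinite if `q = 0`). -/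
noncomputable def transitionTime (P : Matrix V V ℝ) (lam : V → ℝ) (n : ℕ)
    (ω : (ℕ → State V n) × (ℕ → ℝ)) (k : ℕ) : ℝ≥0∞ :=
  ∑ i ∈ Finset.range k, ENNReal.ofReal (ω.2 i) / exitRate P lam n (ω.1 i)

open Classical in
/-- The state at time `t`: it is `ω.1 k` for `transitionTime k ≤ t < transitionTime (k + 1)`. -/
noncomputable def stateAt (P : Matrix V V ℝ) (lam : V → ℝ) (n : ℕ)
    (ω : (ℕ → State V n) × (ℕ → ℝ)) (t : ℝ≥0) : State V n :=
  if h : ∃ k, (t : ℝ≥0∞) < transitionTime P lam n ω (k + 1) then ω.1 (Nat.find h) else ω.1 0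

/-- The process is in state `z` from some time on. -/
def EndsIn (P : Matrix V V ℝ) (lam : V → ℝ) (n : ℕ)
    (ω : (ℕ → State V n) × (ℕ → ℝ)) (z : State V n) : Prop :=
  ∀ᶠ t : ℝ≥0 in atTop, stateAt P lam n ω t = z

/-- The process terminates in a stable configuration. -/
def Stabilizes (P : Matrix V V ℝ) (lam : V → ℝ) (n : ℕ)
    (ω : (ℕ → State V n) × (ℕ → ℝ)) : Prop :=
  ∃ z, z.config.Stable ∧ EndsIn P lam n ω z

open Classical in
/-- The terminal state of the process (with an arbitrary value if there is none). -/
noncomputable def finalState (P : Matrix V V ℝ) (lam : V → ℝ) (n : ℕ)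
    (ω : (ℕ → State V n) × (ℕ → ℝ)) : State V n :=
  if h : ∃ z, EndsIn P lam n ω z then h.choose else ω.1 0

/-- Number of sleepy particles in village `x` in the final configuration. -/
noncomputable def sleepyCount (P : Matrix V V ℝ) (lam : V → ℝ) (n : ℕ)
    (ω : (ℕ → State V n) × (ℕ → ℝ)) (x : V) : ℕ :=
  Fintype.card {i : Fin n // (finalState P lam n ω).config (x, i) = HouseState.sleepy}

/-- Number of times a particle jumped from a house of village `x` during stabilization. -/
noncomputable def jumpOdometer (P : Matrix V V ℝ) (lam : V → ℝ) (n : ℕ)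
    (ω : (ℕ → State V n) × (ℕ → ℝ)) (x : V) : ℕ :=
  (finalState P lam n ω).odometer x

/-! ### The limiting equations -/

/-- `(s, m) ∈ [0, 1]^V × [0, ∞)^V` solves the mass-balance and the last-exit equations. -/
structure IsSolution (P : Matrix V V ℝ) (lam σ ν : V → ℝ) (s m : V → ℝ) : Prop where
  s_mem : ∀ x, s x ∈ Set.Icc (0 : ℝ) 1
  m_nonneg : ∀ x, 0 ≤ m x
  balance : ∀ x, s x = -m x + σ x + ν x + ∑ y, m y * P y x
  lastExit : ∀ x, s x = σ x * Real.exp (-(ν x + ∑ y, m y * P y x))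
    + lam x / (1 + lam x) * (1 - Real.exp (-(ν x + ∑ y, m y * P y x)))

end Dynamics

/-- Convergence in probability to a constant vector `c`, for random vectors `f n` each defined on
its own probability space. -/
def TendstoInProbability {V : Type*} [Fintype V] {Ω : ℕ+ → Type*} [∀ n, MeasurableSpace (Ω n)]
    (μ : (n : ℕ+) → Measure (Ω n)) (f : (n : ℕ+) → Ω n → V → ℝ) (c : V → ℝ) : Prop :=
  ∀ ε : ℝ, 0 < ε → Tendsto (fun n => μ n {ω | ε ≤ ‖f n ω - c‖}) atTop (𝓝 0)

end VARW

namespace VARW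

/-! ### The jump chain -/

section Chain

variable {V : Type*}

/-! The process is followed along its jump chain, and everything is read off from quantities whose
drift is controlled at each single transition; no abelian property is needed.

Number of transitions. Since `P` is irreducible and loses mass somewhere, there is `w ≥ 1` with `1 +
P w ≤ w` (`exists_weight`). `State.energy`, twice the `w`-weighted number of particles minus the
number of sleepers, is nonnegative and drops by at least 1 on average at each transition out of an
unstable state (`houseSum_energy_le`). So the chain stabilizes almost surely, after O(n) transitions
in mean.

Fluctuations. Two observables are attached to each village. `State.flow`, the influx minus what the
odometers predict through `P`, is a martingale with bounded increments; it yields the mass balance.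
`State.villageDev` credits each unstable house with `r = λ / (1 + λ)`, the probability that a lone
active particle falls asleep before it jumps. Between arrivals this credit is fair, because `λ (1 -
r) = r`; an arrival in a uniform house resets its credit to `r`, so after `A` arrivals the total
credit has relaxed towards `r n` by the factor `exp (-A / n)`, and the deviation from this curve is
pulled towards 0 up to a bounded error. This yields the last-exit equation. Both squares grow by
O(1) on average per transition, so a multiple of the energy compensates the growth: the final value
has second moment O(n) (`law_le_abs_finalState_le`), and by Chebyshev a deviation of order `n` has
probability O(1/n).

Deterministic part. In a stable state, mass and credit both count the sleepers, so the rescaled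
counts solve the limiting equations up to a small error. As `σ ≤ r`, both `occFlow` and its
difference from the identity are nondecreasing and 1-Lipschitz in the number of arrivals per house.
Once `s` is eliminated, the equation for `m` is a fixed-point problem dominated by the transpose of
`P`, which contracts the `w`-weighted ℓ¹ norm. This gives existence, uniqueness and stability
(`exists_isSolution`, `IsSolution.abs_sub_le_of_approx`). -/

instance : Countable HouseState :=
  Function.Injective.countable (f := fun s : HouseState => match s with
    | .sleepy => (none : Option ℕ)
    | .active k => some k) (by
      intro a b hab
      cases a <;> cases b <;> simp_all)

instance {n : ℕ} [Finite V] : Countable (State V n) :=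
  Function.Injective.countable (f := fun z : State V n => (z.config, z.odometer)) (by
    intro a b hab
    exact State.ext (congrArg Prod.fst hab) (congrArg Prod.snd hab))

instance {n : ℕ} : DiscreteMeasurableSpace (State V n) := ⟨fun _ => trivial⟩

variable [Fintype V] [DecidableEq V] (P : Matrix V V ℝ) (lam ν : V → ℝ) (n : ℕ+)
  (D : V → Finset (Fin n))

instance : IsProbabilityMeasure (chainLaw P lam ν n D) := by
  unfold chainLaw
  infer_instance

theorem lintegral_chainLaw_zero (F : State V n → ℝ≥0∞) :
    ∫⁻ ω, F (ω 0) ∂(chainLaw P lam ν n D) = ∫⁻ z, F z ∂(initialLaw ν n D) := by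
  have hF : Measurable F := measurable_from_top
  have h1 : (chainLaw P lam ν n D).map (fun ω => ω 0) = initialLaw ν n D := by
    have h2 : (fun ω : ℕ → State V n => ω 0) =
        (fun x : (Finset.Iic 0 → State V n) => x ⟨0, Finset.mem_Iic.2 le_rfl⟩) ∘
          Preorder.frestrictLe (π := fun _ => State V n) 0 := rfl
    rw [h2, ← Measure.map_map (by fun_prop) (by fun_prop), chainLaw, Kernel.trajMeasure,
      Measure.map_comp _ _ (by fun_prop), Kernel.traj_map_frestrictLe,
      Kernel.partialTraj_self, Measure.id_comp, Measure.map_map (by fun_prop) (by fun_prop)]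
    exact Measure.map_id
  rw [← h1, lintegral_map hF (measurable_pi_apply 0)]

/-- Markov property: the joint law of the history up to `k` and the next state is a composition
product with `historyKernel`, which sees only the last coordinate. -/
theorem lintegral_chainLaw_pair (G : State V n → State V n → ℝ≥0∞) (k : ℕ) :
    ∫⁻ ω, G (ω k) (ω (k + 1)) ∂(chainLaw P lam ν n D) =
      ∫⁻ ω, ∫⁻ z, G (ω k) z ∂(nextLaw P lam n (ω k)) ∂(chainLaw P lam ν n D) := by
  have hG : Measurable (Function.uncurry G) := measurable_of_countable _
  have hlast : Measurable fun x : (Finset.Iic k → State V n) =>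
      x ⟨k, Finset.mem_Iic.2 le_rfl⟩ := measurable_pi_apply _
  have hG' : Measurable fun p : (Finset.Iic k → State V n) × State V n =>
      G (p.1 ⟨k, Finset.mem_Iic.2 le_rfl⟩) p.2 :=
    hG.comp ((hlast.comp measurable_fst).prodMk measurable_snd)
  have key := Kernel.map_frestrictLe_trajMeasure_compProd_eq_map_trajMeasure
    (X := fun _ => State V n) (μ₀ := initialLaw ν n D) (κ := historyKernel P lam n) (a := k)
  have h1 : ∫⁻ ω, G (ω k) (ω (k + 1)) ∂(chainLaw P lam ν n D) =
      ∫⁻ p, G (p.1 ⟨k, Finset.mem_Iic.2 le_rfl⟩) p.2 ∂((chainLaw P lam ν n D).map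
        (fun x ↦ (Preorder.frestrictLe (π := fun _ => State V n) k x, x (k + 1)))) := by
    rw [lintegral_map hG' (by fun_prop)]
    rfl
  rw [h1, chainLaw, ← key, Measure.lintegral_compProd hG', lintegral_map _ (by fun_prop)]
  · rfl
  · exact Measurable.lintegral_kernel_prod_right' hG'

theorem ae_chainLaw_of_ae_nextLaw (R : State V n → State V n → Prop)
    (hR : ∀ z, ∀ᵐ z' ∂(nextLaw P lam n z), R z z') :
    ∀ᵐ ω ∂(chainLaw P lam ν n D), ∀ k, R (ω k) (ω (k + 1)) := by
  classical
  rw [ae_all_iff]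
  intro k
  have h := lintegral_chainLaw_pair P lam ν n D (fun z z' => if R z z' then 0 else 1) k
  have h0 : ∀ z, ∫⁻ z', (if R z z' then 0 else 1 : ℝ≥0∞) ∂(nextLaw P lam n z) = 0 := by
    intro z
    rw [lintegral_eq_zero_iff measurable_from_top]
    filter_upwards [hR z] with z' hz'
    simp [hz']
  simp only [h0, lintegral_zero] at h
  have hm : Measurable (fun p : State V n × State V n =>
    (if R p.1 p.2 then 0 else 1 : ℝ≥0∞)) := measurable_of_countable _
  have hm' : Measurable fun ω : ℕ → State V n => (if R (ω k) (ω (k + 1)) then 0 else 1 : ℝ≥0∞) :=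
    hm.comp (f := fun ω : ℕ → State V n => (ω k, ω (k + 1)))
      ((measurable_pi_apply k).prodMk (measurable_pi_apply (k + 1)))
  rw [lintegral_eq_zero_iff hm'] at h
  filter_upwards [h] with ω hω
  by_contra hc
  simp [hc] at hω

/-- A function that decreases on average along the transitions decreases on average along the
chain, with the same gain. -/
theorem lintegral_chainLaw_succ_add_le (F G : State V n → ℝ≥0∞)
    (hF : ∀ z, ∫⁻ z', F z' ∂(nextLaw P lam n z) + G z ≤ F z) (k : ℕ) :
    ∫⁻ ω, F (ω (k + 1)) ∂(chainLaw P lam ν n D) + ∫⁻ ω, G (ω k) ∂(chainLaw P lam ν n D) ≤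
      ∫⁻ ω, F (ω k) ∂(chainLaw P lam ν n D) := by
  rw [lintegral_chainLaw_pair P lam ν n D (fun _ z' => F z') k, ← lintegral_add_right]
  · exact lintegral_mono fun ω => hF (ω k)
  · exact (measurable_from_top (f := G)).comp (measurable_pi_apply k)

/-- Fatou for a nonnegative supermartingale. The liminf suffices since it is used on trajectories
that are eventually constant. -/
theorem lintegral_liminf_chainLaw_le (F : State V n → ℝ≥0∞)
    (hF : ∀ z, ∫⁻ z', F z' ∂(nextLaw P lam n z) ≤ F z) :
    ∫⁻ ω, liminf (fun k => F (ω k)) atTop ∂(chainLaw P lam ν n D) ≤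
      ∫⁻ z, F z ∂(initialLaw ν n D) := by
  have hle : ∀ k, ∫⁻ ω, F (ω k) ∂(chainLaw P lam ν n D) ≤ ∫⁻ z, F z ∂(initialLaw ν n D) := by
    intro k
    induction k with
    | zero => exact (lintegral_chainLaw_zero P lam ν n D F).le
    | succ k ih =>
      have := lintegral_chainLaw_succ_add_le P lam ν n D F 0 (by simpa using hF) k
      simp only [Pi.zero_apply, lintegral_zero, add_zero] at this
      exact this.trans ih
  calc ∫⁻ ω, liminf (fun k => F (ω k)) atTop ∂(chainLaw P lam ν n D)
      ≤ liminf (fun k => ∫⁻ ω, F (ω k) ∂(chainLaw P lam ν n D)) atTop :=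
        lintegral_liminf_le fun k => (measurable_from_top (f := F)).comp (measurable_pi_apply k)
    _ ≤ _ := by
        refine liminf_le_of_frequently_le' (Eventually.frequently (Eventually.of_forall hle))

/-- If a function decreases by at least `1` on average at each transition from a state outside
`A`, then the chain is almost surely in `A` at all but finitely many times. -/
theorem ae_eventually_mem (A : Set (State V n)) (F : State V n → ℝ≥0∞)
    (hF : ∀ z, ∫⁻ z', F z' ∂(nextLaw P lam n z) + Aᶜ.indicator 1 z ≤ F z)
    (hfin : ∫⁻ z, F z ∂(initialLaw ν n D) ≠ ∞) :
    ∀ᵐ ω ∂(chainLaw P lam ν n D), ∀ᶠ k in atTop, ω k ∈ A := by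
  -- Telescoped drift: the mean time spent outside `A` is paid for by the initial value of `F`.
  -- Borel–Cantelli then concludes.
  have hsum : ∀ k, ∑ i ∈ Finset.range k, (chainLaw P lam ν n D) {ω | ω i ∉ A} +
      ∫⁻ ω, F (ω k) ∂(chainLaw P lam ν n D) ≤ ∫⁻ z, F z ∂(initialLaw ν n D) := by
    intro k
    induction k with
    | zero => simpa using (lintegral_chainLaw_zero P lam ν n D F).le
    | succ k ih =>
      have h := lintegral_chainLaw_succ_add_le P lam ν n D F _ hF k
      have h2 : ∫⁻ ω, Aᶜ.indicator 1 (ω k) ∂(chainLaw P lam ν n D) =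
          (chainLaw P lam ν n D) {ω | ω k ∉ A} := by
        have hm : MeasurableSet {ω : ℕ → State V n | ω k ∉ A} :=
          measurableSet_preimage (f := fun ω : ℕ → State V n => ω k) (measurable_pi_apply k)
            (MeasurableSet.of_discrete (s := Aᶜ))
        rw [← lintegral_indicator_one hm]
        rfl
      rw [h2] at h
      rw [Finset.sum_range_succ, add_assoc]
      refine le_trans ?_ ih
      gcongr
      rw [add_comm]
      exact h
  have htsum : ∑' i, (chainLaw P lam ν n D) {ω | ω i ∉ A} ≠ ∞ := by
    refine ne_top_of_le_ne_top hfin ?_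
    rw [ENNReal.tsum_eq_iSup_nat]
    exact iSup_le fun k => le_trans le_self_add (hsum k)
  filter_upwards [ae_eventually_notMem htsum] with ω hω
  filter_upwards [hω] with k hk
  simpa using hk

end Chain

/-! ### Total rates as positive linear functionals -/

section Generator

variable {V : Type*} [Fintype V] [DecidableEq V] (P : Matrix V V ℝ) (lam : V → ℝ)

/-- Sum of the values of `f` after the transitions triggered by the house `h`, weighted by the
rates of these transitions. -/
noncomputable def houseSum (n : ℕ) (z : State V n) (h : House V n) (f : State V n → ℝ) : ℝ :=
  (∑ h' : House V n, (z.config h).numActive * (P h.1 h'.1 / n) * f (z.jump h h'))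
    + (z.config h).numActive * (1 - ∑ y, P h.1 y) * f (z.exit h)
    + (if (z.config h).numActive = 1 then lam h.1 else 0) * f (z.sleep h)

/-- Total rate of the transitions triggered by the house `h`. -/
noncomputable def houseRate (n : ℕ) (z : State V n) (h : House V n) : ℝ :=
  (z.config h).numActive + (if (z.config h).numActive = 1 then lam h.1 else 0)

omit [DecidableEq V] in
theorem sum_house_div (n : ℕ) (hn : n ≠ 0) (f : V → ℝ) :
    ∑ h' : House V n, f h'.1 / n = ∑ y, f y := by
  have hn' : (n : ℝ) ≠ 0 := by exact_mod_cast hn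
  rw [Fintype.sum_prod_type]
  refine Finset.sum_congr rfl fun y _ => ?_
  simp [mul_div_cancel₀ _ hn']

theorem houseSum_const (n : ℕ) (hn : n ≠ 0) (z : State V n) (h : House V n) (c : ℝ) :
    houseSum P lam n z h (fun _ => c) = c * houseRate lam n z h := by
  unfold houseSum houseRate
  rw [← Finset.sum_mul, ← Finset.mul_sum, sum_house_div n hn]
  ring

theorem houseSum_add (n : ℕ) (z : State V n) (h : House V n) (f g : State V n → ℝ) :
    houseSum P lam n z h (fun z' => f z' + g z') =
      houseSum P lam n z h f + houseSum P lam n z h g := by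
  unfold houseSum
  simp only [mul_add, Finset.sum_add_distrib]
  ring

theorem houseSum_const_mul (n : ℕ) (z : State V n) (h : House V n) (c : ℝ) (f : State V n → ℝ) :
    houseSum P lam n z h (fun z' => c * f z') = c * houseSum P lam n z h f := by
  unfold houseSum
  rw [mul_add, mul_add, Finset.mul_sum]
  congr 1
  · congr 1
    · exact Finset.sum_congr rfl fun _ _ => by ring
    · ring
  · ring

omit [Fintype V] [DecidableEq V] in
theorem houseRate_nonneg (hlam : ∀ x, 0 ≤ lam x) (n : ℕ) (z : State V n) (h : House V n) :
    0 ≤ houseRate lam n z h := by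
  unfold houseRate
  split_ifs
  · exact add_nonneg (Nat.cast_nonneg _) (hlam _)
  · simp

omit [Fintype V] [DecidableEq V] in
theorem houseRate_eq_zero (n : ℕ) (z : State V n) (h : House V n)
    (hz : (z.config h).numActive = 0) : houseRate lam n z h = 0 := by
  simp [houseRate, hz]

theorem houseSum_eq_zero (n : ℕ) (z : State V n) (h : House V n)
    (hz : (z.config h).numActive = 0) (f : State V n → ℝ) : houseSum P lam n z h f = 0 := by
  simp [houseSum, hz]

variable {P lam} (hP : ∀ x y, 0 ≤ P x y) (hP1 : ∀ x, ∑ y, P x y ≤ 1) (hlam : ∀ x, 0 ≤ lam x)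

include hP hP1 hlam in
theorem houseSum_mono (n : ℕ) (z : State V n) (h : House V n) (f g : State V n → ℝ)
    (hjump : ∀ h', (z.config h).numActive ≠ 0 → f (z.jump h h') ≤ g (z.jump h h'))
    (hexit : (z.config h).numActive ≠ 0 → f (z.exit h) ≤ g (z.exit h))
    (hsleep : (z.config h).numActive = 1 → f (z.sleep h) ≤ g (z.sleep h)) :
    houseSum P lam n z h f ≤ houseSum P lam n z h g := by
  by_cases h0 : (z.config h).numActive = 0
  · rw [houseSum_eq_zero _ _ _ _ _ h0, houseSum_eq_zero _ _ _ _ _ h0]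
  have h1 : 0 ≤ 1 - ∑ y, P h.1 y := sub_nonneg.2 (hP1 _)
  unfold houseSum
  refine add_le_add (add_le_add (Finset.sum_le_sum fun h' _ => ?_) ?_) ?_
  · have := hP h.1 h'.1
    exact mul_le_mul_of_nonneg_left (hjump h' h0) (by positivity)
  · exact mul_le_mul_of_nonneg_left (hexit h0) (by positivity)
  · split_ifs with h2
    · exact mul_le_mul_of_nonneg_left (hsleep h2) (hlam _)
    · simp

include hP hP1 hlam in
theorem houseSum_nonneg (n : ℕ) (z : State V n) (h : House V n) (f : State V n → ℝ)
    (hf : ∀ z, 0 ≤ f z) : 0 ≤ houseSum P lam n z h f := by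
  have h1 : 0 ≤ 1 - ∑ y, P h.1 y := sub_nonneg.2 (hP1 _)
  unfold houseSum
  refine add_nonneg (add_nonneg (Finset.sum_nonneg fun h' _ => ?_) ?_) ?_
  · have := hP h.1 h'.1
    exact mul_nonneg (by positivity) (hf _)
  · exact mul_nonneg (by positivity) (hf _)
  · split_ifs with h2
    · exact mul_nonneg (hlam _) (hf _)
    · simp

include hP hP1 hlam in
-- Bridge from measure-valued rates to real sums, where increments can be subtracted.
theorem lintegral_rates (n : ℕ) (z : State V n) (f : State V n → ℝ) (hf : ∀ z, 0 ≤ f z) :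
    ∫⁻ z', ENNReal.ofReal (f z') ∂(rates P lam n z) =
      ENNReal.ofReal (∑ h, houseSum P lam n z h f) := by
  have h1 : ∀ x, 0 ≤ 1 - ∑ y, P x y := fun x => sub_nonneg.2 (hP1 x)
  rw [ENNReal.ofReal_sum_of_nonneg fun h _ => houseSum_nonneg hP hP1 hlam n z h f hf]
  unfold rates
  rw [lintegral_finsetSum_measure]
  refine Finset.sum_congr rfl fun h _ => ?_
  have h2 : ∀ h' : House V n, 0 ≤ ((z.config h).numActive : ℝ) * (P h.1 h'.1 / n) := fun h' => by
    have := hP h.1 h'.1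
    positivity
  have h3 : 0 ≤ ((z.config h).numActive : ℝ) * (1 - ∑ y, P h.1 y) :=
    mul_nonneg (Nat.cast_nonneg _) (h1 _)
  have h4 : 0 ≤ if (z.config h).numActive = 1 then lam h.1 else 0 := by
    split_ifs
    · exact hlam _
    · exact le_rfl
  have h5 : (if (z.config h).numActive = 1 then ENNReal.ofReal (lam h.1) else 0) =
      ENNReal.ofReal (if (z.config h).numActive = 1 then lam h.1 else 0) := by
    split_ifs <;> simp
  rw [lintegral_add_measure, lintegral_add_measure, lintegral_finsetSum_measure, h5]
  simp only [lintegral_smul_measure, lintegral_dirac, smul_eq_mul]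
  unfold houseSum
  have hs : 0 ≤ ∑ h' : House V n, (z.config h).numActive * (P h.1 h'.1 / n) * f (z.jump h h') :=
    Finset.sum_nonneg fun h' _ => mul_nonneg (h2 h') (hf _)
  rw [ENNReal.ofReal_add (add_nonneg hs (mul_nonneg h3 (hf _))) (mul_nonneg h4 (hf _)),
    ENNReal.ofReal_add hs (mul_nonneg h3 (hf _)),
    ENNReal.ofReal_sum_of_nonneg fun h' _ => mul_nonneg (h2 h') (hf _),
    ENNReal.ofReal_mul h3, ENNReal.ofReal_mul h4]
  congr 2
  exact Finset.sum_congr rfl fun h' _ => (ENNReal.ofReal_mul (h2 h')).symm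

include hP hP1 hlam in
theorem exitRate_eq (n : ℕ) (hn : n ≠ 0) (z : State V n) :
    exitRate P lam n z = ENNReal.ofReal (∑ h, houseRate lam n z h) := by
  have := lintegral_rates hP hP1 hlam n z (fun _ => 1) (fun _ => zero_le_one)
  simp only [ENNReal.ofReal_one, lintegral_one, houseSum_const P lam n hn, one_mul] at this
  exact this

include hP hP1 hlam in
theorem exitRate_eq_zero_iff (n : ℕ) (hn : n ≠ 0) (z : State V n) :
    exitRate P lam n z = 0 ↔ z.config.Stable := by
  rw [exitRate_eq hP hP1 hlam n hn, ENNReal.ofReal_eq_zero]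
  constructor
  · intro hle h
    have h0 := (Finset.sum_eq_zero_iff_of_nonneg
      (fun h _ => houseRate_nonneg lam hlam n z h)).1
      (le_antisymm hle (Finset.sum_nonneg fun h _ => houseRate_nonneg lam hlam n z h))
      h (Finset.mem_univ _)
    by_contra hne
    have hpos : 0 < ((z.config h).numActive : ℝ) := by
      exact_mod_cast Nat.pos_of_ne_zero hne
    unfold houseRate at h0
    split_ifs at h0
    · linarith [hlam h.1]
    · linarith
  · intro hs
    exact (Finset.sum_eq_zero fun h _ => houseRate_eq_zero lam n z h (hs h)).le

include hP hP1 hlam in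
-- The house rates add up to the exit rate, so drift inequalities checked house by house can be
-- summed and divided by it.
theorem lintegral_nextLaw_add_le (n : ℕ) (hn : n ≠ 0) (z : State V n) (f : State V n → ℝ)
    (hf : ∀ z, 0 ≤ f z) (c : ℝ) (hc : 0 ≤ c)
    (hdrift : ∀ h, houseSum P lam n z h f ≤ (f z - c) * houseRate lam n z h)
    (hz : ¬ z.config.Stable) :
    ∫⁻ z', ENNReal.ofReal (f z') ∂(nextLaw P lam n z) + ENNReal.ofReal c ≤
      ENNReal.ofReal (f z) := by
  have hq : exitRate P lam n z ≠ 0 := fun h => hz ((exitRate_eq_zero_iff hP hP1 hlam n hn z).1 h)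
  have hqt := exitRate_ne_top P lam n z
  unfold nextLaw
  rw [if_neg hq, lintegral_smul_measure, lintegral_rates hP hP1 hlam n z f hf, smul_eq_mul]
  set q := ∑ h, houseRate lam n z h with hqdef
  have hq0 : 0 ≤ q := Finset.sum_nonneg fun h _ => houseRate_nonneg lam hlam n z h
  rw [exitRate_eq hP hP1 hlam n hn, ← hqdef] at hq hqt ⊢
  have hsum : ∑ h, houseSum P lam n z h f + c * q ≤ q * f z := by
    have : ∑ h, houseSum P lam n z h f ≤ (f z - c) * q := by
      rw [hqdef, Finset.mul_sum]
      exact Finset.sum_le_sum fun h _ => hdrift h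
    linarith
  have hs0 : 0 ≤ ∑ h, houseSum P lam n z h f :=
    Finset.sum_nonneg fun h _ => houseSum_nonneg hP hP1 hlam n z h f hf
  have hkey : ENNReal.ofReal (∑ h, houseSum P lam n z h f) + ENNReal.ofReal q * ENNReal.ofReal c ≤
      ENNReal.ofReal q * ENNReal.ofReal (f z) := by
    rw [← ENNReal.ofReal_mul hq0, ← ENNReal.ofReal_mul hq0,
      ← ENNReal.ofReal_add hs0 (mul_nonneg hq0 hc)]
    exact ENNReal.ofReal_le_ofReal (by linarith)
  calc (ENNReal.ofReal q)⁻¹ * ENNReal.ofReal (∑ h, houseSum P lam n z h f) + ENNReal.ofReal c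
      = (ENNReal.ofReal q)⁻¹ * (ENNReal.ofReal (∑ h, houseSum P lam n z h f) +
          ENNReal.ofReal q * ENNReal.ofReal c) := by
        rw [mul_add, ← mul_assoc, ENNReal.inv_mul_cancel hq hqt, one_mul]
    _ ≤ (ENNReal.ofReal q)⁻¹ * (ENNReal.ofReal q * ENNReal.ofReal (f z)) := by gcongr
    _ = ENNReal.ofReal (f z) := by
        rw [← mul_assoc, ENNReal.inv_mul_cancel hq hqt, one_mul]

include hP hP1 hlam in
theorem nextLaw_of_stable (n : ℕ) (hn : n ≠ 0) (z : State V n) (hz : z.config.Stable) :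
    nextLaw P lam n z = Measure.dirac z := by
  unfold nextLaw
  rw [if_pos ((exitRate_eq_zero_iff hP hP1 hlam n hn z).2 hz)]

include hP hP1 hlam in
/-- A function with bounded increments whose drift does not push it away from `0` has a square
whose drift is bounded by a multiple of the rate. -/
theorem houseSum_sq_le (n : ℕ) (hn : n ≠ 0) (z : State V n) (h : House V n) (X : State V n → ℝ)
    (b c : ℝ)
    (hjump : ∀ h', (z.config h).numActive ≠ 0 → |X (z.jump h h') - X z| ≤ b)
    (hexit : (z.config h).numActive ≠ 0 → |X (z.exit h) - X z| ≤ b)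
    (hsleep : (z.config h).numActive = 1 → |X (z.sleep h) - X z| ≤ b)
    (hdrift : X z * houseSum P lam n z h (fun z' => X z' - X z) ≤ c * houseRate lam n z h) :
    houseSum P lam n z h (fun z' => X z' ^ 2) ≤
      (X z ^ 2 + (2 * c + b ^ 2)) * houseRate lam n z h := by
  have hsq : ∀ z', |X z' - X z| ≤ b →
      X z' ^ 2 ≤ X z ^ 2 + b ^ 2 + 2 * X z * (X z' - X z) := by
    intro z' hz'
    have := sq_le_sq' (neg_le_of_abs_le hz') (le_of_abs_le hz')
    nlinarith
  have h1 := houseSum_mono hP hP1 hlam n z h (fun z' => X z' ^ 2)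
    (fun z' => X z ^ 2 + b ^ 2 + 2 * X z * (X z' - X z))
    (fun h' h0 => hsq _ (hjump h' h0)) (fun h0 => hsq _ (hexit h0)) (fun h0 => hsq _ (hsleep h0))
  rw [houseSum_add P lam n z h (fun _ => X z ^ 2 + b ^ 2), houseSum_const P lam n hn,
    houseSum_const_mul] at h1
  nlinarith

end Generator

/-! ### Functions of the configuration of one village -/

namespace HouseState

/-- Number of particles in a house. -/
def total : HouseState → ℕ
  | sleepy => 1
  | active k => k

/-- Probability `r` that an unstable house ends up occupied if it is stabilized on its own; a
stable house keeps its particle, if any. -/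
def occ (r : ℝ) : HouseState → ℝ
  | sleepy => 1
  | active 0 => 0
  | active (_ + 1) => r

/-- Indicator function of the sleepy state. -/
def isSleepy : HouseState → ℝ
  | sleepy => 1
  | active _ => 0

theorem total_land (s : HouseState) : s.land.total = s.total + 1 := by
  cases s <;> rfl

theorem occ_land (r : ℝ) (s : HouseState) : s.land.occ r = r := by
  cases s <;> rfl

theorem isSleepy_land (s : HouseState) : s.land.isSleepy = 0 := by
  cases s <;> rfl

theorem occ_mem {r : ℝ} (h0 : 0 ≤ r) (h1 : r ≤ 1) (s : HouseState) :
    0 ≤ s.occ r ∧ s.occ r ≤ 1 := by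
  rcases s with _ | _ | _ <;> simp [occ, h0, h1]

end HouseState

/-- Deviation of a village of `n` houses, `d` of which were initially occupied by a sleepy
particle, from its typical occupation after `A` arrivals. -/
noncomputable def occDev {n : ℕ} (r d : ℝ) (η : Fin n → HouseState) (A : ℝ) : ℝ :=
  ∑ i, (η i).occ r - r * n - (d - r * n) * Real.exp (-(A / n))

section OccDev

variable {n : ℕ} {r d A : ℝ}

theorem sum_comp_update {ι α : Type*} [Fintype ι] [DecidableEq ι] (g : ι → α → ℝ) (η : ι → α)
    (j : ι) (s : α) :
    ∑ i, g i (Function.update η j s i) = ∑ i, g i (η i) + (g j s - g j (η j)) := by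
  have h : ∑ i, (g i (Function.update η j s i) - g i (η i)) = g j s - g j (η j) := by
    rw [Finset.sum_eq_single j]
    · simp
    · intro i _ hi
      simp [hi]
    · simp
  rw [Finset.sum_sub_distrib] at h
  linarith

theorem sum_occ_mem (h0 : 0 ≤ r) (h1 : r ≤ 1) (η : Fin n → HouseState) :
    0 ≤ ∑ i, (η i).occ r ∧ ∑ i, (η i).occ r ≤ n := by
  constructor
  · exact Finset.sum_nonneg fun i _ => (HouseState.occ_mem h0 h1 _).1
  · calc ∑ i, (η i).occ r ≤ ∑ _i : Fin n, (1 : ℝ) :=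
        Finset.sum_le_sum fun i _ => (HouseState.occ_mem h0 h1 _).2
      _ = n := by simp

/-- Drift bounds are needed at every state, reachable or not. There the arrival count `influx - d`
is only known to be at least `-n`, at the price of a factor `e ≤ 3`. -/
theorem exp_neg_div_le (hn : n ≠ 0) (hA : -(n : ℝ) ≤ A) : Real.exp (-(A / n)) ≤ 3 := by
  have hn' : (0 : ℝ) < n := by exact_mod_cast Nat.pos_of_ne_zero hn
  have h1 : -(A / n) ≤ 1 := by
    rw [← neg_div, div_le_one hn']
    linarith
  exact (Real.exp_le_exp.2 h1).trans (by linarith [Real.exp_one_lt_d9])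

theorem abs_sub_le_card (h0 : 0 ≤ r) (h1 : r ≤ 1) (hd0 : 0 ≤ d) (hd : d ≤ n) :
    |d - r * n| ≤ n := by
  have hn' : (0 : ℝ) ≤ n := Nat.cast_nonneg n
  rw [abs_le]
  constructor <;> nlinarith

theorem abs_mul_exp_le (hn : n ≠ 0) (h0 : 0 ≤ r) (h1 : r ≤ 1) (hd0 : 0 ≤ d) (hd : d ≤ n)
    (hA : -(n : ℝ) ≤ A) : |(d - r * n) * Real.exp (-(A / n))| ≤ n * 3 := by
  rw [abs_mul, abs_of_pos (Real.exp_pos _)]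
  exact mul_le_mul (abs_sub_le_card h0 h1 hd0 hd) (exp_neg_div_le hn hA) (Real.exp_pos _).le
    (Nat.cast_nonneg _)

theorem abs_occDev_le (hn : n ≠ 0) (h0 : 0 ≤ r) (h1 : r ≤ 1) (hd0 : 0 ≤ d) (hd : d ≤ n)
    (hA : -(n : ℝ) ≤ A) (η : Fin n → HouseState) : |occDev r d η A| ≤ 4 * n := by
  have hw := sum_occ_mem h0 h1 η
  have he := abs_le.1 (abs_mul_exp_le hn h0 h1 hd0 hd hA)
  have hn' : (0 : ℝ) ≤ n := Nat.cast_nonneg n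
  unfold occDev
  rw [abs_le]
  constructor <;> nlinarith

/-- A landing sets the credit of the house to `r`, whatever it was, and multiplies the exponential
by `exp (-1 / n)`. -/
theorem occDev_land_sub (η : Fin n → HouseState) (j : Fin n) :
    occDev r d (Function.update η j (η j).land) (A + 1) - occDev r d η A =
      r - (η j).occ r + (d - r * n) * Real.exp (-(A / n)) * (1 - Real.exp (-(1 / n))) := by
  unfold occDev
  rw [sum_comp_update (fun _ => HouseState.occ r), HouseState.occ_land,
    show -((A + 1) / (n : ℝ)) = -(A / n) + -(1 / n) by ring, Real.exp_add]
  ring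

theorem one_sub_exp_mem (n : ℕ) :
    0 ≤ 1 - Real.exp (-(1 / n)) ∧ 1 - Real.exp (-(1 / n)) ≤ 1 / n := by
  constructor
  · rw [sub_nonneg, Real.exp_le_one_iff]
    simp
  · have := Real.add_one_le_exp (-(1 / (n : ℝ)))
    linarith

theorem abs_occDev_land_sub_le (hn : n ≠ 0) (h0 : 0 ≤ r) (h1 : r ≤ 1) (hd0 : 0 ≤ d) (hd : d ≤ n)
    (hA : -(n : ℝ) ≤ A) (η : Fin n → HouseState) (j : Fin n) :
    |occDev r d (Function.update η j (η j).land) (A + 1) - occDev r d η A| ≤ 4 := by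
  have hn' : (0 : ℝ) < n := by exact_mod_cast Nat.pos_of_ne_zero hn
  rw [occDev_land_sub]
  have h2 := HouseState.occ_mem h0 h1 (η j)
  have h3 : |r - (η j).occ r| ≤ 1 := by
    rw [abs_le]
    constructor <;> linarith
  have h4 := one_sub_exp_mem n
  have h5 : |(d - r * n) * Real.exp (-(A / n)) * (1 - Real.exp (-(1 / n)))| ≤ 3 := by
    rw [abs_mul, abs_of_nonneg h4.1]
    calc _ ≤ (n * 3 : ℝ) * (1 / n) :=
          mul_le_mul (abs_mul_exp_le hn h0 h1 hd0 hd hA) h4.2 h4.1 (by positivity)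
      _ = 3 := by field_simp
  exact (abs_add_le _ _).trans (by linarith)

/-- A uniformly chosen arrival contracts the deviation by the factor `1 - 1 / n`, up to a small
error. -/
theorem abs_sum_occDev_land_sub_add_le (hn : n ≠ 0) (h0 : 0 ≤ r) (h1 : r ≤ 1) (hd0 : 0 ≤ d)
    (hd : d ≤ n) (hA : -(n : ℝ) ≤ A) (η : Fin n → HouseState) :
    |∑ j, (occDev r d (Function.update η j (η j).land) (A + 1) - occDev r d η A) +
      occDev r d η A| ≤ 3 := by
  have hn' : (0 : ℝ) < n := by exact_mod_cast Nat.pos_of_ne_zero hn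
  have h2 : ∑ j, (occDev r d (Function.update η j (η j).land) (A + 1) - occDev r d η A) +
      occDev r d η A =
      (d - r * n) * Real.exp (-(A / n)) * (n * (1 - Real.exp (-(1 / n))) - 1) := by
    simp only [occDev_land_sub, Finset.sum_add_distrib, Finset.sum_sub_distrib, Finset.sum_const,
      Finset.card_univ, Fintype.card_fin, nsmul_eq_mul]
    unfold occDev
    ring
  -- Second-order error of the exponential at `-1 / n`, multiplied by `n`.
  have h3 : |n * (1 - Real.exp (-(1 / n))) - 1| ≤ 1 / (n : ℝ) := by
    have hle : |-(1 / (n : ℝ))| ≤ 1 := by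
      rw [abs_neg, abs_of_pos (by positivity), div_le_one hn']
      exact_mod_cast Nat.one_le_iff_ne_zero.2 hn
    have := Real.abs_exp_sub_one_sub_id_le hle
    have h4 : n * (1 - Real.exp (-(1 / n))) - 1 =
        -(n * (Real.exp (-(1 / (n : ℝ))) - 1 - -(1 / n))) := by
      field_simp
      ring
    rw [h4, abs_neg, abs_mul, abs_of_pos hn']
    calc _ ≤ (n : ℝ) * (-(1 / (n : ℝ))) ^ 2 := by gcongr
      _ = 1 / n := by field_simp
  rw [h2, abs_mul]
  calc _ ≤ (n * 3 : ℝ) * (1 / n) :=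
        mul_le_mul (abs_mul_exp_le hn h0 h1 hd0 hd hA) h3 (abs_nonneg _) (by positivity)
    _ = 3 := by field_simp

/-- Expand the squares. Squared increments cost 16 each; the cross term is `-2 X ^ 2` plus an error
of at most `2 * (4 n) * 3`, that is 24 per house. Hence 40. -/
theorem sum_occDev_land_sq_le (hn : n ≠ 0) (h0 : 0 ≤ r) (h1 : r ≤ 1) (hd0 : 0 ≤ d)
    (hd : d ≤ n) (hA : -(n : ℝ) ≤ A) (η : Fin n → HouseState) :
    ∑ j, occDev r d (Function.update η j (η j).land) (A + 1) ^ 2 ≤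
      n * (occDev r d η A ^ 2 + 40) := by
  set X := occDev r d η A with hX
  have hn' : (0 : ℝ) < n := by exact_mod_cast Nat.pos_of_ne_zero hn
  have h2 : ∀ j, occDev r d (Function.update η j (η j).land) (A + 1) ^ 2 ≤
      X ^ 2 + 16 + 2 * X * (occDev r d (Function.update η j (η j).land) (A + 1) - X) := by
    intro j
    have := abs_le.1 (abs_occDev_land_sub_le hn h0 h1 hd0 hd hA η j)
    rw [← hX] at this
    have := sq_le_sq' this.1 this.2
    nlinarith
  have h3 := abs_sum_occDev_land_sub_add_le hn h0 h1 hd0 hd hA η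
  rw [← hX] at h3
  have h4 : |X| ≤ 4 * n := abs_occDev_le hn h0 h1 hd0 hd hA η
  set S := ∑ j, (occDev r d (Function.update η j (η j).land) (A + 1) - X)
  have h5 : X * (S + X) ≤ 12 * n := by
    calc X * (S + X) ≤ |X * (S + X)| := le_abs_self _
      _ = |X| * |S + X| := abs_mul _ _
      _ ≤ (4 * n) * 3 := mul_le_mul h4 h3 (abs_nonneg _) (by positivity)
      _ = 12 * n := by ring
  calc _ ≤ ∑ j, (X ^ 2 + 16 +
        2 * X * (occDev r d (Function.update η j (η j).land) (A + 1) - X)) :=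
        Finset.sum_le_sum fun j _ => h2 j
    _ = n * (X ^ 2 + 16) + 2 * X * S := by
        rw [Finset.sum_add_distrib, ← Finset.mul_sum, Finset.sum_const, Finset.card_univ,
          Fintype.card_fin, nsmul_eq_mul]
    _ ≤ _ := by nlinarith [sq_nonneg X]

end OccDev

/-! ### Observables of the process -/

namespace State

variable {V : Type*} {n : ℕ}

/-- Number of particles in village `y`. -/
noncomputable def mass (z : State V n) (y : V) : ℝ :=
  ∑ i, ((z.config (y, i)).total : ℝ)

/-- Number of particles that are or have been in village `y`. -/
noncomputable def influx (z : State V n) (y : V) : ℝ :=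
  z.mass y + z.odometer y

theorem influx_nonneg (z : State V n) (y : V) : 0 ≤ z.influx y :=
  add_nonneg (Finset.sum_nonneg fun _ _ => Nat.cast_nonneg _) (Nat.cast_nonneg _)

/-- An active particle is added in the house `h`. -/
def landAt [DecidableEq V] (z : State V n) (h : House V n) : State V n where
  config := Function.update z.config h (z.config h).land
  odometer := z.odometer

/-- Deviation of village `y` from its typical occupation. -/
noncomputable def villageDev (z : State V n) (y : V) (r d : ℝ) : ℝ :=
  occDev r d (fun i => z.config (y, i)) (z.influx y - d)

section Observables

variable [DecidableEq V]

/-- Valid also for `h' = h`; it lets departures and landings be analysed separately. -/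
theorem jump_eq (z : State V n) (h h' : House V n) : z.jump h h' = (z.exit h).landAt h' := rfl

theorem sum_village_update (g : HouseState → ℝ) (η : Config V n) (h : House V n) (s : HouseState)
    (y : V) :
    ∑ i, g (Function.update η h s (y, i)) =
      ∑ i, g (η (y, i)) + if h.1 = y then g s - g (η h) else 0 := by
  obtain ⟨x, j⟩ := h
  split_ifs with hxy
  · simp only at hxy
    subst hxy
    rw [← sum_comp_update (fun _ => g) (fun i => η (x, i)) j s]
    refine Finset.sum_congr rfl fun i _ => ?_
    by_cases hij : i = j
    · subst hij
      simp
    · simp [hij]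
  · rw [add_zero]
    refine Finset.sum_congr rfl fun i _ => ?_
    rw [Function.update_of_ne]
    rintro heq
    exact hxy (congrArg Prod.fst heq).symm

theorem mass_landAt (z : State V n) (h : House V n) (y : V) :
    (z.landAt h).mass y = z.mass y + if h.1 = y then 1 else 0 := by
  unfold mass landAt
  rw [sum_village_update (fun s => (s.total : ℝ)), HouseState.total_land]
  simp

theorem influx_landAt (z : State V n) (h : House V n) (y : V) :
    (z.landAt h).influx y = z.influx y + if h.1 = y then 1 else 0 := by
  unfold influx
  rw [mass_landAt]
  simp only [landAt]
  ring

theorem mass_exit (z : State V n) (h : House V n) (hz : (z.config h).numActive ≠ 0) (y : V) :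
    (z.exit h).mass y = z.mass y - if h.1 = y then 1 else 0 := by
  unfold mass exit
  rw [sum_village_update (fun s => (s.total : ℝ))]
  rcases hs : z.config h with _ | _ | k
  · simp [hs, HouseState.numActive] at hz
  · simp [hs, HouseState.numActive] at hz
  · split_ifs <;> simp [HouseState.total, HouseState.leave]
    ring

theorem odometer_exit (z : State V n) (h : House V n) (y : V) :
    ((z.exit h).odometer y : ℝ) = z.odometer y + if h.1 = y then 1 else 0 := by
  unfold exit
  by_cases hy : h.1 = y
  · subst hy
    simp
  · simp [Function.update_of_ne (Ne.symm hy), hy]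

theorem influx_exit (z : State V n) (h : House V n) (hz : (z.config h).numActive ≠ 0) (y : V) :
    (z.exit h).influx y = z.influx y := by
  unfold influx
  rw [mass_exit z h hz, odometer_exit]
  ring

omit [DecidableEq V] in
theorem config_eq_of_numActive_eq_one (z : State V n) (h : House V n)
    (hz : (z.config h).numActive = 1) : z.config h = .active 1 := by
  rcases hs : z.config h with _ | k
  · simp [hs, HouseState.numActive] at hz
  · simp only [hs, HouseState.numActive] at hz
    rw [hz]

theorem mass_sleep (z : State V n) (h : House V n) (hz : (z.config h).numActive = 1) (y : V) :
    (z.sleep h).mass y = z.mass y := by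
  unfold mass sleep
  rw [sum_village_update (fun s => (s.total : ℝ)), config_eq_of_numActive_eq_one z h hz]
  simp [HouseState.total]

theorem influx_sleep (z : State V n) (h : House V n) (hz : (z.config h).numActive = 1) (y : V) :
    (z.sleep h).influx y = z.influx y := by
  unfold influx
  rw [mass_sleep z h hz]
  rfl

variable (r d : ℝ) (y : V)

/-- A departure matters only when it empties the house: otherwise the house stays unstable and keeps
the credit `r`. -/
theorem villageDev_exit (z : State V n) (h : House V n) (hz : (z.config h).numActive ≠ 0) :
    (z.exit h).villageDev y r d - z.villageDev y r d =
      if h.1 = y ∧ (z.config h).numActive = 1 then -r else 0 := by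
  unfold villageDev occDev
  rw [influx_exit z h hz]
  simp only [exit]
  rw [sum_village_update (HouseState.occ r)]
  rcases hs : z.config h with _ | _ | _ | k
  · simp [hs, HouseState.numActive] at hz
  · simp [hs, HouseState.numActive] at hz
  · by_cases hy : h.1 = y <;> simp [hy, HouseState.occ, HouseState.leave, HouseState.numActive]
  · by_cases hy : h.1 = y <;> simp [hy, HouseState.occ, HouseState.leave, HouseState.numActive]

theorem villageDev_sleep (z : State V n) (h : House V n) (hz : (z.config h).numActive = 1) :
    (z.sleep h).villageDev y r d - z.villageDev y r d = if h.1 = y then 1 - r else 0 := by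
  unfold villageDev occDev
  rw [influx_sleep z h hz]
  simp only [sleep]
  rw [sum_village_update (HouseState.occ r), config_eq_of_numActive_eq_one z h hz]
  simp only [HouseState.occ]
  ring

theorem villageDev_landAt_same (z : State V n) (j : Fin n) :
    (z.landAt (y, j)).villageDev y r d =
      occDev r d (Function.update (fun i => z.config (y, i)) j (z.config (y, j)).land)
        (z.influx y - d + 1) := by
  unfold villageDev
  rw [influx_landAt]
  congr 1
  · funext i
    simp only [landAt]
    by_cases hij : i = j
    · subst hij
      simp
    · simp [hij]
  · simp
    ring

theorem villageDev_landAt_of_ne (z : State V n) (h : House V n) (hy : h.1 ≠ y) :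
    (z.landAt h).villageDev y r d = z.villageDev y r d := by
  unfold villageDev
  rw [influx_landAt]
  congr 1
  · funext i
    simp only [landAt]
    rw [Function.update_of_ne]
    rintro heq
    exact hy (congrArg Prod.fst heq).symm
  · simp [hy]

end Observables

end State

/-! ### Drift of the observables under a single transition -/

section Drift

variable {V : Type*} [Fintype V] [DecidableEq V] {P : Matrix V V ℝ} {lam : V → ℝ}
  (hP : ∀ x y, 0 ≤ P x y) (hP1 : ∀ x, ∑ y, P x y ≤ 1) (hlam : ∀ x, 0 ≤ lam x)

/-- Decomposition of the increments along a jump into the departure and the landing. -/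
theorem houseSum_sub (n : ℕ) (hn : n ≠ 0) (z : State V n) (h : House V n) (f : State V n → ℝ) :
    houseSum P lam n z h (fun z' => f z' - f z) =
      (z.config h).numActive * ∑ h' : House V n, P h.1 h'.1 / n *
          (f ((z.exit h).landAt h') - f (z.exit h))
        + (z.config h).numActive * (f (z.exit h) - f z)
        + (if (z.config h).numActive = 1 then lam h.1 else 0) * (f (z.sleep h) - f z) := by
  unfold houseSum
  have h1 := sum_house_div n hn (P h.1)
  have h2 : ∑ h' : House V n, (z.config h).numActive * (P h.1 h'.1 / n) *
      (f (z.jump h h') - f z) = (z.config h).numActive * ∑ h' : House V n, P h.1 h'.1 / n *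
          (f ((z.exit h).landAt h') - f (z.exit h)) +
      (z.config h).numActive * ((∑ h' : House V n, P h.1 h'.1 / n) * (f (z.exit h) - f z)) := by
    rw [Finset.sum_mul, Finset.mul_sum, Finset.mul_sum, ← Finset.sum_add_distrib]
    refine Finset.sum_congr rfl fun h' _ => ?_
    rw [State.jump_eq]
    ring
  rw [h2, h1]
  ring

omit [DecidableEq V] in
theorem sum_house_eq_village {n : ℕ} (y : V) (f : House V n → ℝ) (hf : ∀ h, h.1 ≠ y → f h = 0) :
    ∑ h, f h = ∑ j, f (y, j) := by
  rw [Fintype.sum_prod_type, Finset.sum_eq_single y]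
  · exact fun x _ hx => Finset.sum_eq_zero fun j _ => hf (x, j) hx
  · simp

include hP hP1 hlam in
-- Departures and falling asleep cancel in mean, landings contract the deviation up to a bounded
-- error, and increments are bounded.
theorem houseSum_villageDev_sq_le (n : ℕ) (hn : n ≠ 0) (z : State V n) (h : House V n) (y : V)
    (d : ℝ) (hd0 : 0 ≤ d) (hd : d ≤ n) :
    houseSum P lam n z h (fun z' => z'.villageDev y (lam y / (1 + lam y)) d ^ 2) ≤
      (z.villageDev y (lam y / (1 + lam y)) d ^ 2 + 60) * houseRate lam n z h := by
  by_cases hz : (z.config h).numActive = 0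
  · rw [houseSum_eq_zero _ _ _ _ _ hz, houseRate_eq_zero _ _ _ _ hz, mul_zero]
  set r := lam y / (1 + lam y) with hr
  have hl := hlam y
  have hr0 : 0 ≤ r := by positivity
  have hr1 : r ≤ 1 := by
    rw [hr, div_le_one (by linarith)]
    linarith
  -- Fairness of the credit: sleeping gains `1 - r` at rate `lam y`, leaving loses `r` at rate 1.
  have hlr : lam y * (1 - r) = r := by
    rw [hr]
    field_simp
    ring
  have hn' : (0 : ℝ) < n := by exact_mod_cast Nat.pos_of_ne_zero hn
  set X : State V n → ℝ := fun z' => z'.villageDev y r d with hX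
  have hA : ∀ z' : State V n, -(n : ℝ) ≤ z'.influx y - d := fun z' => by
    linarith [z'.influx_nonneg y]
  have hXle : ∀ z', |X z'| ≤ 4 * n := fun z' => abs_occDev_le hn hr0 hr1 hd0 hd (hA z') _
  have hexit : |X (z.exit h) - X z| ≤ 1 := by
    simp only [hX]
    rw [State.villageDev_exit r d y z h hz]
    split_ifs
    · rw [abs_neg, abs_of_nonneg hr0]
      exact hr1
    · simp
  have hland : ∀ h', |X ((z.exit h).landAt h') - X (z.exit h)| ≤ 4 := by
    intro h'
    by_cases hy : h'.1 = y
    · obtain ⟨y', j⟩ := h'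
      simp only at hy
      subst hy
      simp only [hX]
      rw [State.villageDev_landAt_same]
      exact abs_occDev_land_sub_le hn hr0 hr1 hd0 hd (hA _) _ j
    · simp only [hX]
      rw [State.villageDev_landAt_of_ne r d y _ h' hy]
      simp
  -- Increments are at most 5: 1 for the departure plus 4 for the landing. The result is `2 * 16 + 5
  -- ^ 2 = 57 ≤ 60`.
  have hb := houseSum_sq_le hP hP1 hlam n hn z h X 5 16 ?_ ?_ ?_ ?_
  · refine hb.trans (mul_le_mul_of_nonneg_right ?_ (houseRate_nonneg lam hlam n z h))
    norm_num
    linarith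
  · intro h' _
    rw [State.jump_eq]
    have := abs_sub_le (X ((z.exit h).landAt h')) (X (z.exit h)) (X z)
    linarith [hland h']
  · exact fun _ => hexit.trans (by norm_num)
  · intro h1
    simp only [hX]
    rw [State.villageDev_sleep r d y z h h1]
    split_ifs
    · rw [abs_of_nonneg (by linarith)]
      linarith
    · simp
  · rw [houseSum_sub n hn]
    have h1 : (z.config h).numActive * (X (z.exit h) - X z)
        + (if (z.config h).numActive = 1 then lam h.1 else 0) * (X (z.sleep h) - X z) = 0 := by
      by_cases ha : (z.config h).numActive = 1
      · simp only [hX]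
        rw [State.villageDev_exit r d y z h hz, State.villageDev_sleep r d y z h ha, ha]
        by_cases hy : h.1 = y
        · simp only [hy, and_self, if_true]
          rw [hlr]
          simp
        · simp [hy]
      · simp only [hX]
        rw [State.villageDev_exit r d y z h hz]
        simp [ha]
    rw [add_assoc, h1, add_zero]
    rw [sum_house_eq_village y]
    swap
    · intro h' hy
      simp only [hX]
      rw [State.villageDev_landAt_of_ne r d y _ h' hy, sub_self, mul_zero]
    dsimp only
    rw [← Finset.mul_sum]
    set S := ∑ j, (X ((z.exit h).landAt (y, j)) - X (z.exit h)) with hS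
    have hS3 : |S + X (z.exit h)| ≤ 3 := by
      have := abs_sum_occDev_land_sub_add_le hn hr0 hr1 hd0 hd (hA (z.exit h))
        (fun i => (z.exit h).config (y, i))
      rw [hS]
      simp only [hX, State.villageDev_landAt_same]
      exact this
    -- The contraction is towards 0 from the state after departure; replacing `X (z.exit h)` by `X
    -- z` costs `4 n`, and `-(X z) ^ 2` is dropped.
    have h2 : X z * S ≤ 16 * n := by
      have e1 : X z * (S + X (z.exit h)) ≤ 12 * n := by
        calc _ ≤ |X z * (S + X (z.exit h))| := le_abs_self _
          _ = |X z| * |S + X (z.exit h)| := abs_mul _ _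
          _ ≤ (4 * n) * 3 := mul_le_mul (hXle z) hS3 (abs_nonneg _) (by positivity)
          _ = 12 * n := by ring
      have e2 : -(X z * (X (z.exit h) - X z)) ≤ 4 * n := by
        calc _ ≤ |X z * (X (z.exit h) - X z)| := neg_le_abs _
          _ = |X z| * |X (z.exit h) - X z| := abs_mul _ _
          _ ≤ (4 * n) * 1 := mul_le_mul (hXle z) hexit (abs_nonneg _) (by positivity)
          _ = 4 * n := by ring
      nlinarith [sq_nonneg (X z)]
    have hp0 := hP h.1 y
    have hp1 : P h.1 y ≤ 1 :=
      (Finset.single_le_sum (fun y _ => hP h.1 y) (Finset.mem_univ y)).trans (hP1 _)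
    have ha : ((z.config h).numActive : ℝ) ≤ houseRate lam n z h := by
      unfold houseRate
      have := hlam h.1
      split_ifs <;> linarith
    calc X z * ((z.config h).numActive * (P h.1 y / n * S))
        = (z.config h).numActive * (P h.1 y / n) * (X z * S) := by ring
      _ ≤ (z.config h).numActive * (P h.1 y / n) * (16 * n) := by gcongr
      _ = 16 * (P h.1 y * (z.config h).numActive) := by field_simp
      _ ≤ 16 * (1 * houseRate lam n z h) := by gcongr
      _ = 16 * houseRate lam n z h := by ring

namespace State

/-- Difference between the influx of village `y` and its conditional mean given the jumps. -/
noncomputable def flow (P : Matrix V V ℝ) {n : ℕ} (z : State V n) (y : V) : ℝ :=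
  z.influx y - ∑ x, z.odometer x * P x y

theorem flow_exit {n : ℕ} (z : State V n) (h : House V n) (hz : (z.config h).numActive ≠ 0)
    (y : V) : (z.exit h).flow P y = z.flow P y - P h.1 y := by
  unfold flow
  rw [influx_exit z h hz]
  simp only [odometer_exit, add_mul, Finset.sum_add_distrib, ite_mul, one_mul, zero_mul,
    Finset.sum_ite_eq, Finset.mem_univ, if_true]
  ring

theorem flow_landAt {n : ℕ} (z : State V n) (h : House V n) (y : V) :
    (z.landAt h).flow P y = z.flow P y + if h.1 = y then 1 else 0 := by
  unfold flow
  rw [influx_landAt]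
  simp only [landAt]
  ring

theorem flow_sleep {n : ℕ} (z : State V n) (h : House V n) (hz : (z.config h).numActive = 1)
    (y : V) : (z.sleep h).flow P y = z.flow P y := by
  unfold flow
  rw [influx_sleep z h hz]
  rfl

/-- A weighted number of particles, minus the number of sleepy particles. -/
noncomputable def energy (w : V → ℝ) {n : ℕ} (z : State V n) : ℝ :=
  ∑ y, (2 * w y * z.mass y - ∑ i, (z.config (y, i)).isSleepy)

omit [DecidableEq V] in
theorem energy_nonneg (w : V → ℝ) (hw : ∀ x, 1 ≤ w x) {n : ℕ} (z : State V n) :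
    0 ≤ z.energy w := by
  refine Finset.sum_nonneg fun y _ => ?_
  unfold mass
  rw [Finset.mul_sum, ← Finset.sum_sub_distrib]
  refine Finset.sum_nonneg fun i _ => ?_
  have := hw y
  rcases z.config (y, i) with _ | k
  · simp only [HouseState.total, HouseState.isSleepy]
    norm_num
    linarith
  · simp only [HouseState.total, HouseState.isSleepy]
    have : (0 : ℝ) ≤ k := Nat.cast_nonneg k
    nlinarith

theorem energy_exit (w : V → ℝ) {n : ℕ} (z : State V n) (h : House V n)
    (hz : (z.config h).numActive ≠ 0) : (z.exit h).energy w = z.energy w - 2 * w h.1 := by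
  unfold energy
  simp only [mass_exit z h hz]
  have h1 : ∀ y, ∑ i, ((z.exit h).config (y, i)).isSleepy = ∑ i, (z.config (y, i)).isSleepy := by
    intro y
    simp only [exit]
    rw [sum_village_update HouseState.isSleepy]
    rcases hs : z.config h with _ | k
    · simp [hs, HouseState.numActive] at hz
    · simp [HouseState.isSleepy, HouseState.leave]
  simp only [h1, mul_sub, Finset.sum_sub_distrib, mul_ite, mul_one, mul_zero, Finset.sum_ite_eq,
    Finset.mem_univ, if_true]
  ring

theorem energy_landAt_le (w : V → ℝ) {n : ℕ} (z : State V n) (h : House V n) :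
    (z.landAt h).energy w ≤ z.energy w + (2 * w h.1 + 1) := by
  unfold energy
  have h1 : ∀ y, ∑ i, ((z.landAt h).config (y, i)).isSleepy =
      ∑ i, (z.config (y, i)).isSleepy - if h.1 = y then (z.config h).isSleepy else 0 := by
    intro y
    simp only [landAt]
    rw [sum_village_update HouseState.isSleepy, HouseState.isSleepy_land]
    split_ifs <;> ring
  have h2 : (z.config h).isSleepy ≤ 1 := by
    rcases z.config h with _ | k <;> simp [HouseState.isSleepy]
  simp only [h1, mass_landAt, mul_add, Finset.sum_add_distrib, Finset.sum_sub_distrib, mul_ite,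
    mul_one, mul_zero, Finset.sum_ite_eq, Finset.mem_univ, if_true]
  linarith

theorem energy_sleep (w : V → ℝ) {n : ℕ} (z : State V n) (h : House V n)
    (hz : (z.config h).numActive = 1) : (z.sleep h).energy w = z.energy w - 1 := by
  unfold energy
  have h1 : ∀ y, ∑ i, ((z.sleep h).config (y, i)).isSleepy =
      ∑ i, (z.config (y, i)).isSleepy + if h.1 = y then 1 else 0 := by
    intro y
    simp only [sleep]
    rw [sum_village_update HouseState.isSleepy, config_eq_of_numActive_eq_one z h hz]
    simp [HouseState.isSleepy]
  simp only [h1, mass_sleep z h hz, Finset.sum_add_distrib, Finset.sum_sub_distrib,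
    Finset.sum_ite_eq, Finset.mem_univ, if_true]
  ring

end State

include hP hP1 hlam in
-- A departure subtracts `P h.1 y`, and the landing adds 1 with exactly this probability: a
-- martingale with increments at most 1. The constant 60 is not sharp.
theorem houseSum_flow_sq_le (n : ℕ) (hn : n ≠ 0) (z : State V n) (h : House V n) (y : V) (c : ℝ) :
    houseSum P lam n z h (fun z' => (z'.flow P y - c) ^ 2) ≤
      ((z.flow P y - c) ^ 2 + 60) * houseRate lam n z h := by
  by_cases hz : (z.config h).numActive = 0
  · rw [houseSum_eq_zero _ _ _ _ _ hz, houseRate_eq_zero _ _ _ _ hz, mul_zero]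
  have hp0 := hP h.1 y
  have hp1 : P h.1 y ≤ 1 :=
    (Finset.single_le_sum (fun y _ => hP h.1 y) (Finset.mem_univ y)).trans (hP1 _)
  have hn' : (n : ℝ) ≠ 0 := by exact_mod_cast hn
  have hb := houseSum_sq_le hP hP1 hlam n hn z h (fun z' => z'.flow P y - c) 1 0 ?_ ?_ ?_ ?_
  · refine hb.trans (mul_le_mul_of_nonneg_right ?_ (houseRate_nonneg lam hlam n z h))
    norm_num
  · intro h' _
    rw [State.jump_eq, State.flow_landAt, State.flow_exit z h hz, abs_le]
    split_ifs <;> constructor <;> linarith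
  · intro _
    rw [State.flow_exit z h hz, abs_le]
    constructor <;> linarith
  · intro h1
    rw [State.flow_sleep z h h1]
    simp
  · rw [houseSum_sub n hn]
    have h1 : (if (z.config h).numActive = 1 then lam h.1 else 0) *
        (((z.sleep h).flow P y - c) - (z.flow P y - c)) = 0 := by
      split_ifs with h1
      · rw [State.flow_sleep z h h1]
        ring
      · ring
    rw [h1, State.flow_exit z h hz]
    simp only [State.flow_landAt, State.flow_exit z h hz]
    have h2 : ∑ h' : House V n, P h.1 h'.1 / n * (z.flow P y - P h.1 y + (if h'.1 = y then 1 else 0)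
        - c - (z.flow P y - P h.1 y - c)) = P h.1 y := by
      have h3 : ∑ x, (if y = x then P h.1 x else 0) = P h.1 y := by simp
      rw [← h3, ← sum_house_div n hn fun x => if y = x then P h.1 x else 0]
      refine Finset.sum_congr rfl fun h' _ => ?_
      by_cases hy : h'.1 = y
      · simp [hy]
      · simp [hy, Ne.symm hy]
    rw [h2]
    ring_nf
    rfl

include hP hP1 in
-- Falling asleep gains 1. A departure releases `2 w`, which must pay the mean arrival cost `2 P w ≤
-- 2 w - 2`, and at most 1 for waking a sleeper; 1 is left over. This is why the weight is doubled.
theorem houseSum_energy_le (w : V → ℝ) (hwP : ∀ x, 1 + ∑ y, P x y * w y ≤ w x) (n : ℕ)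
    (hn : n ≠ 0) (z : State V n) (h : House V n) :
    houseSum P lam n z h (State.energy w) ≤ (z.energy w - 1) * houseRate lam n z h := by
  by_cases hz : (z.config h).numActive = 0
  · rw [houseSum_eq_zero _ _ _ _ _ hz, houseRate_eq_zero _ _ _ _ hz, mul_zero]
  have key : houseSum P lam n z h (fun z' => z'.energy w - z.energy w) ≤
      -houseRate lam n z h := by
    rw [houseSum_sub n hn, State.energy_exit w z h hz]
    have h1 : (if (z.config h).numActive = 1 then lam h.1 else 0) *
        ((z.sleep h).energy w - z.energy w) =
        -(if (z.config h).numActive = 1 then lam h.1 else 0) := by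
      split_ifs with h1
      · rw [State.energy_sleep w z h h1]
        ring
      · ring
    have h2 : ∑ h' : House V n, P h.1 h'.1 / n *
        (((z.exit h).landAt h').energy w - (z.energy w - 2 * w h.1)) ≤ 2 * w h.1 - 1 := by
      calc _ ≤ ∑ h' : House V n, P h.1 h'.1 * (2 * w h'.1 + 1) / n := by
            refine Finset.sum_le_sum fun h' _ => ?_
            have h3 := State.energy_landAt_le w (z.exit h) h'
            rw [State.energy_exit w z h hz] at h3
            have := hP h.1 h'.1
            rw [mul_div_right_comm]
            refine mul_le_mul_of_nonneg_left (by linarith) (by positivity)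
        _ = 2 * ∑ y, P h.1 y * w y + ∑ y, P h.1 y := by
            rw [sum_house_div n hn (fun y => P h.1 y * (2 * w y + 1)), Finset.mul_sum,
              ← Finset.sum_add_distrib]
            exact Finset.sum_congr rfl fun _ _ => by ring
        _ ≤ _ := by linarith [hwP h.1, hP1 h.1]
    rw [h1]
    have ha : (0 : ℝ) ≤ (z.config h).numActive := Nat.cast_nonneg _
    have := mul_le_mul_of_nonneg_left h2 ha
    unfold houseRate
    linarith
  have h3 := houseSum_add P lam n z h (fun z' => z'.energy w - z.energy w) (fun _ => z.energy w)
  rw [houseSum_const P lam n hn] at h3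
  simp only [sub_add_cancel] at h3
  change houseSum P lam n z h (fun z' => z'.energy w) ≤ _
  linarith

end Drift

/-! ### The initial state -/

section Village

variable {n : ℕ}

/-- Initial configuration of one village. -/
def villageConfig (D : Finset (Fin n)) {N : ℕ} (a : Fin N → Fin n) : Fin n → HouseState := fun i =>
  HouseState.land^[Fintype.card {j : Fin N // a j = i}]
    (if i ∈ D then HouseState.sleepy else HouseState.active 0)

/-- Only the number of arrivals in each house matters, so the particle listed first may be treated
as the last to land. -/
theorem villageConfig_cons (D : Finset (Fin n)) {N : ℕ} (j : Fin n) (a : Fin N → Fin n) :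
    villageConfig D (Fin.cons j a : Fin (N + 1) → Fin n) =
      Function.update (villageConfig D a) j (villageConfig D a j).land := by
  have hcard : ∀ i, Fintype.card {k : Fin (N + 1) // (Fin.cons j a : Fin (N + 1) → Fin n) k = i} =
      (if j = i then 1 else 0) + Fintype.card {k : Fin N // a k = i} := by
    intro i
    simp only [Fintype.card_subtype, Finset.card_filter, Fin.sum_univ_succ, Fin.cons_zero,
      Fin.cons_succ]
  funext i
  unfold villageConfig
  rw [hcard]
  by_cases hi : j = i
  · subst hi
    rw [if_pos rfl, Function.update_self, add_comm, Function.iterate_succ_apply']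
  · rw [if_neg hi, zero_add, Function.update_of_ne (Ne.symm hi)]

theorem villageConfig_zero (D : Finset (Fin n)) (a : Fin 0 → Fin n) (i : Fin n) :
    villageConfig D a i = if i ∈ D then HouseState.sleepy else HouseState.active 0 := by
  simp [villageConfig]

theorem sum_total_villageConfig (D : Finset (Fin n)) {N : ℕ} (a : Fin N → Fin n) :
    ∑ i, ((villageConfig D a i).total : ℝ) = D.card + N := by
  induction N with
  | zero =>
    have h : ∀ i, ((villageConfig D a i).total : ℝ) = if i ∈ D then 1 else 0 := by
      intro i
      rw [villageConfig_zero]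
      split_ifs <;> simp [HouseState.total]
    simp [h]
  | succ N ih =>
    rw [← Fin.cons_self_tail a, villageConfig_cons,
      sum_comp_update (fun _ (s : HouseState) => (s.total : ℝ)), ih, HouseState.total_land]
    push_cast
    ring

/-- Second moment in counting form, over the `n ^ N` equally likely choices: each arrival adds at
most 40 to the mean square. -/
theorem sum_occDev_villageConfig_sq_le (hn : n ≠ 0) {r : ℝ} (h0 : 0 ≤ r) (h1 : r ≤ 1)
    (D : Finset (Fin n)) (N : ℕ) :
    ∑ a : Fin N → Fin n, occDev r D.card (villageConfig D a) N ^ 2 ≤ (n : ℝ) ^ N * (40 * N) := by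
  have hd : (D.card : ℝ) ≤ n := by
    exact_mod_cast (Finset.card_le_univ D).trans_eq (Fintype.card_fin n)
  induction N with
  | zero =>
    have h : ∀ a : Fin 0 → Fin n, occDev r D.card (villageConfig D a) 0 = 0 := by
      intro a
      have h : ∀ i, (villageConfig D a i).occ r = if i ∈ D then 1 else 0 := by
        intro i
        rw [villageConfig_zero]
        split_ifs <;> simp [HouseState.occ]
      simp [occDev, h]
    simp [h]
  | succ N ih =>
    rw [← (Fin.consEquiv fun _ : Fin (N + 1) => Fin n).sum_comp, Fintype.sum_prod_type_right]
    have hstep : ∀ a : Fin N → Fin n,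
        ∑ j : Fin n, occDev r D.card
          (villageConfig D ((Fin.consEquiv fun _ : Fin (N + 1) => Fin n) (j, a))) (N + 1 : ℕ) ^ 2 ≤
        n * (occDev r D.card (villageConfig D a) N ^ 2 + 40) := by
      intro a
      have hA : -(n : ℝ) ≤ N := by
        have : (0 : ℝ) ≤ n := Nat.cast_nonneg _
        have : (0 : ℝ) ≤ N := Nat.cast_nonneg _
        linarith
      have := sum_occDev_land_sq_le hn h0 h1 (Nat.cast_nonneg _) hd hA (villageConfig D a)
      have hcons : ∀ j, villageConfig D ((Fin.consEquiv fun _ : Fin (N + 1) => Fin n) (j, a)) =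
          Function.update (villageConfig D a) j (villageConfig D a j).land :=
        fun j => villageConfig_cons D j a
      simpa only [hcons, Nat.cast_add, Nat.cast_one] using this
    calc _ ≤ ∑ a : Fin N → Fin n, n * (occDev r D.card (villageConfig D a) N ^ 2 + 40) :=
          Finset.sum_le_sum fun a _ => hstep a
      _ = n * (∑ a : Fin N → Fin n, occDev r D.card (villageConfig D a) N ^ 2 +
            (n : ℝ) ^ N * 40) := by
          rw [← Finset.mul_sum, Finset.sum_add_distrib]
          simp
      _ ≤ n * ((n : ℝ) ^ N * (40 * N) + (n : ℝ) ^ N * 40) := by gcongr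
      _ = _ := by
          push_cast
          ring

end Village

section Initial

variable {V : Type*} [Fintype V] [DecidableEq V]

omit [Fintype V] [DecidableEq V] in
theorem initialState_config {n : ℕ} (D : V → Finset (Fin n)) (N : V → ℕ)
    (arr : (x : V) → Fin (N x) → Fin n) (y : V) (i : Fin n) :
    (initialState D N arr).config (y, i) = villageConfig (D y) (arr y) i := rfl

omit [Fintype V] [DecidableEq V] in
theorem influx_initialState {n : ℕ} (D : V → Finset (Fin n)) (N : V → ℕ)
    (arr : (x : V) → Fin (N x) → Fin n) (y : V) :
    (initialState D N arr).influx y = (D y).card + N y := by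
  unfold State.influx State.mass
  simp only [initialState_config, sum_total_villageConfig]
  simp [initialState]

omit [DecidableEq V] in
theorem flow_initialState {n : ℕ} (P : Matrix V V ℝ) (D : V → Finset (Fin n)) (N : V → ℕ)
    (arr : (x : V) → Fin (N x) → Fin n) (y : V) :
    (initialState D N arr).flow P y = (D y).card + N y := by
  unfold State.flow
  rw [influx_initialState]
  simp [initialState]

omit [DecidableEq V] in
theorem energy_initialState_le {n : ℕ} (w : V → ℝ) (D : V → Finset (Fin n)) (N : V → ℕ)
    (arr : (x : V) → Fin (N x) → Fin n) :
    (initialState D N arr).energy w ≤ ∑ y, 2 * w y * ((D y).card + N y) := by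
  unfold State.energy State.mass
  refine Finset.sum_le_sum fun y _ => ?_
  simp only [initialState_config, sum_total_villageConfig]
  have : 0 ≤ ∑ i, (villageConfig (D y) (arr y) i).isSleepy :=
    Finset.sum_nonneg fun i _ => by
      rcases villageConfig (D y) (arr y) i with _ | k <;> simp [HouseState.isSleepy]
  linarith

omit [Fintype V] [DecidableEq V] in
theorem villageDev_initialState {n : ℕ} (D : V → Finset (Fin n)) (N : V → ℕ)
    (arr : (x : V) → Fin (N x) → Fin n) (y : V) (r : ℝ) :
    (initialState D N arr).villageDev y r (D y).card =
      occDev r (D y).card (villageConfig (D y) (arr y)) (N y) := by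
  unfold State.villageDev
  rw [influx_initialState, add_sub_cancel_left]
  rfl

theorem sum_comp_eval_le {ι : Type*} [Fintype ι] [DecidableEq ι] {α : ι → Type*}
    [∀ i, Fintype (α i)] (i : ι) (F : α i → ℝ) (B : ℝ)
    (hF : ∑ a, F a ≤ Fintype.card (α i) * B) :
    ∑ p : (j : ι) → α j, F (p i) ≤ Fintype.card ((j : ι) → α j) * B := by
  rw [Fintype.card_congr (Equiv.piSplitAt i α), Fintype.card_prod,
    ← (Equiv.piSplitAt i α).symm.sum_comp, Fintype.sum_prod_type_right]
  simp only [Equiv.piSplitAt_symm_apply, dite_true]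
  rw [Finset.sum_const, Finset.card_univ, nsmul_eq_mul]
  push_cast
  rw [mul_comm (Fintype.card (α i) : ℝ), mul_assoc]
  exact mul_le_mul_of_nonneg_left hF (Nat.cast_nonneg _)

theorem lintegral_initialLaw (ν : V → ℝ) (n : ℕ+) (D : V → Finset (Fin n))
    (F : State V n → ℝ) (hF : ∀ z, 0 ≤ F z) :
    ∫⁻ z, ENNReal.ofReal (F z) ∂(initialLaw ν n D) =
      ENNReal.ofReal ((∑ arr : (x : V) → Fin ⌊ν x * n⌋₊ → Fin n,
        F (initialState D (fun x => ⌊ν x * n⌋₊) arr)) /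
          Fintype.card ((x : V) → Fin ⌊ν x * n⌋₊ → Fin n)) := by
  unfold initialLaw
  rw [lintegral_map measurable_from_top (measurable_of_finite _), lintegral_fintype]
  simp only [PMF.toMeasure_apply_singleton _ _ (MeasurableSet.singleton _),
    PMF.uniformOfFintype_apply]
  have hc : (0 : ℝ) < Fintype.card ((x : V) → Fin ⌊ν x * n⌋₊ → Fin n) := by
    exact_mod_cast Fintype.card_pos
  rw [← Finset.sum_mul, ENNReal.ofReal_div_of_pos hc, ENNReal.ofReal_natCast,
    ENNReal.ofReal_sum_of_nonneg fun _ _ => hF _, div_eq_mul_inv]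

theorem lintegral_initialLaw_le (ν : V → ℝ) (n : ℕ+) (D : V → Finset (Fin n))
    (F : State V n → ℝ) (hF : ∀ z, 0 ≤ F z) (B : ℝ)
    (hB : ∑ arr : (x : V) → Fin ⌊ν x * n⌋₊ → Fin n,
      F (initialState D (fun x => ⌊ν x * n⌋₊) arr) ≤
        Fintype.card ((x : V) → Fin ⌊ν x * n⌋₊ → Fin n) * B) :
    ∫⁻ z, ENNReal.ofReal (F z) ∂(initialLaw ν n D) ≤ ENNReal.ofReal B := by
  rw [lintegral_initialLaw ν n D F hF]
  have hc : (0 : ℝ) < Fintype.card ((x : V) → Fin ⌊ν x * n⌋₊ → Fin n) := by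
    exact_mod_cast Fintype.card_pos
  refine ENNReal.ofReal_le_ofReal ?_
  rw [div_le_iff₀ hc, mul_comm]
  exact hB

theorem sum_villageDev_initialState_sq_le (n : ℕ) (hn : n ≠ 0) (D : V → Finset (Fin n))
    (N : V → ℕ) (y : V) {r : ℝ} (h0 : 0 ≤ r) (h1 : r ≤ 1) :
    ∑ arr : (x : V) → Fin (N x) → Fin n,
      (initialState D N arr).villageDev y r (D y).card ^ 2 ≤
        Fintype.card ((x : V) → Fin (N x) → Fin n) * (40 * N y) := by
  simp only [villageDev_initialState]
  refine sum_comp_eval_le (α := fun x => Fin (N x) → Fin n) y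
    (fun a => occDev r (D y).card (villageConfig (D y) a) (N y) ^ 2) _ ?_
  refine (sum_occDev_villageConfig_sq_le hn h0 h1 (D y) (N y)).trans_eq ?_
  simp

end Initial

/-! ### Termination and the final state -/

section Final

variable {V : Type*} [Fintype V] [DecidableEq V] {P : Matrix V V ℝ} {lam : V → ℝ}
  (hP : ∀ x y, 0 ≤ P x y) (hP1 : ∀ x, ∑ y, P x y ≤ 1) (hlam : ∀ x, 0 ≤ lam x)

theorem monotone_transitionTime (n : ℕ) (ω : (ℕ → State V n) × (ℕ → ℝ)) :
    Monotone (transitionTime P lam n ω) :=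
  monotone_nat_of_le_succ fun k => by
    unfold transitionTime
    rw [Finset.sum_range_succ]
    exact le_self_add

include hP hP1 hlam in
/-- A trajectory of the jump chain that reaches a stable state, and stays there, gives a process
that ends in this state. -/
theorem exists_endsIn (n : ℕ) (hn : n ≠ 0) (ω : (ℕ → State V n) × (ℕ → ℝ))
    (hpos : ∀ i, 0 < ω.2 i) (habs : ∀ k, (ω.1 k).config.Stable → ω.1 (k + 1) = ω.1 k)
    (hst : ∃ k, (ω.1 k).config.Stable) :
    ∃ z, z.config.Stable ∧ EndsIn P lam n ω z ∧ ∀ᶠ k in atTop, ω.1 k = z := by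
  classical
  set K := Nat.find hst with hK
  have hKst : (ω.1 K).config.Stable := Nat.find_spec hst
  have hfin : transitionTime P lam n ω K ≠ ∞ := by
    refine ENNReal.sum_ne_top.2 fun i hi => ENNReal.div_ne_top ENNReal.ofReal_ne_top ?_
    rw [Ne, exitRate_eq_zero_iff hP hP1 hlam n hn]
    exact Nat.find_min hst (Finset.mem_range.1 hi)
  have htop : transitionTime P lam n ω (K + 1) = ∞ := by
    unfold transitionTime
    -- Positivity of the exponential variable matters: in `ℝ≥0∞`, a positive number divided by 0 is
    -- `∞`, but `0 / 0 = 0`.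
    rw [Finset.sum_range_succ, (exitRate_eq_zero_iff hP hP1 hlam n hn _).2 hKst,
      ENNReal.div_zero (by simpa using hpos K), add_top]
  refine ⟨ω.1 K, hKst, ?_, ?_⟩
  · filter_upwards [eventually_ge_atTop (transitionTime P lam n ω K).toNNReal] with t ht
    have ht' : transitionTime P lam n ω K ≤ t := by
      rw [← ENNReal.coe_toNNReal hfin]
      exact_mod_cast ht
    have hex : ∃ k, (t : ℝ≥0∞) < transitionTime P lam n ω (k + 1) :=
      ⟨K, htop ▸ ENNReal.coe_lt_top⟩
    unfold stateAt
    rw [dif_pos hex]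
    refine congrArg ω.1 ?_
    rw [Nat.find_eq_iff]
    refine ⟨htop ▸ ENNReal.coe_lt_top, fun m hm => not_lt.2 ?_⟩
    exact (monotone_transitionTime n ω (Nat.succ_le_of_lt hm)).trans ht'
  · have hconst : ∀ j, ω.1 (K + j) = ω.1 K := by
      intro j
      induction j with
      | zero => rfl
      | succ j ih => rw [← add_assoc, habs _ (ih ▸ hKst), ih]
    filter_upwards [eventually_ge_atTop K] with k hk
    rw [← hconst (k - K), Nat.add_sub_cancel' hk]

theorem finalState_eq {n : ℕ} {ω : (ℕ → State V n) × (ℕ → ℝ)} {z : State V n}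
    (hz : EndsIn P lam n ω z) : finalState P lam n ω = z := by
  have hex : ∃ z, EndsIn P lam n ω z := ⟨z, hz⟩
  unfold finalState
  rw [dif_pos hex]
  obtain ⟨t, ht1, ht2⟩ := (hex.choose_spec.and hz).exists
  exact ht1.symm.trans ht2

theorem ae_holdingTimes_pos :
    ∀ᵐ τ ∂(Measure.infinitePi fun _ : ℕ => expMeasure 1), ∀ i, 0 < τ i := by
  rw [ae_all_iff]
  intro i
  have h : ∀ᵐ t ∂(expMeasure 1), 0 < t := by
    have h0 := cdf_expMeasure_eq one_pos 0
    rw [cdf_eq_real, if_pos le_rfl, mul_zero, neg_zero, Real.exp_zero, sub_self,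
      measureReal_eq_zero_iff] at h0
    rw [ae_iff]
    convert h0 using 2
    ext t
    simp
  exact (measurePreserving_eval_infinitePi (fun _ : ℕ => expMeasure 1) i).quasiMeasurePreserving.ae
    h

variable {w : V → ℝ} (hw : ∀ x, 1 ≤ w x) (hwP : ∀ x, 1 + ∑ y, P x y * w y ≤ w x)

include hP hP1 hlam in
theorem ae_absorbing (ν : V → ℝ) (n : ℕ+) (D : V → Finset (Fin n)) :
    ∀ᵐ ω ∂(chainLaw P lam ν n D), ∀ k, (ω k).config.Stable → ω (k + 1) = ω k := by
  refine ae_chainLaw_of_ae_nextLaw P lam ν n D (fun z z' => z.config.Stable → z' = z) fun z => ?_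
  by_cases hz : z.config.Stable
  · rw [nextLaw_of_stable hP hP1 hlam n n.ne_zero z hz, ae_dirac_eq]
    exact fun _ => rfl
  · exact Eventually.of_forall fun z' h => absurd h hz

include hw in
theorem lintegral_energy_initialLaw_le (ν : V → ℝ) (n : ℕ+) (D : V → Finset (Fin n)) :
    ∫⁻ z, ENNReal.ofReal (z.energy w) ∂(initialLaw ν n D) ≤
      ENNReal.ofReal (∑ y, 2 * w y * ((D y).card + ⌊ν y * n⌋₊)) := by
  refine lintegral_initialLaw_le ν n D _ (fun z => State.energy_nonneg w hw z) _ ?_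
  refine (Finset.sum_le_sum fun arr _ => energy_initialState_le w D _ arr).trans_eq ?_
  rw [Finset.sum_const, Finset.card_univ, nsmul_eq_mul]

include hP hP1 hlam hw hwP in
theorem ae_eventually_stable (ν : V → ℝ) (n : ℕ+) (D : V → Finset (Fin n)) :
    ∀ᵐ ω ∂(chainLaw P lam ν n D), ∀ᶠ k in atTop, (ω k).config.Stable := by
  refine ae_eventually_mem P lam ν n D {z | z.config.Stable}
    (fun z => ENNReal.ofReal (z.energy w)) (fun z => ?_)
    (ne_top_of_le_ne_top ENNReal.ofReal_ne_top (lintegral_energy_initialLaw_le hw ν n D))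
  by_cases hz : z.config.Stable
  · rw [nextLaw_of_stable hP hP1 hlam n n.ne_zero z hz, lintegral_dirac]
    simp [hz]
  · have := lintegral_nextLaw_add_le hP hP1 hlam n n.ne_zero z (State.energy w)
      (State.energy_nonneg w hw) 1 zero_le_one
      (fun h => houseSum_energy_le hP hP1 w hwP n n.ne_zero z h) hz
    simpa [hz] using this

include hP hP1 hlam hw hwP in
theorem ae_law_exists_endsIn (ν : V → ℝ) (n : ℕ+) (D : V → Finset (Fin n)) :
    ∀ᵐ ω ∂(law P lam ν n D), ∃ z, z.config.Stable ∧ EndsIn P lam n ω z ∧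
      ∀ᶠ k in atTop, ω.1 k = z := by
  have h1 : ∀ᵐ ω ∂(law P lam ν n D), (∀ k, (ω.1 k).config.Stable → ω.1 (k + 1) = ω.1 k) ∧
      ∀ᶠ k in atTop, (ω.1 k).config.Stable :=
    Measure.quasiMeasurePreserving_fst.ae
      ((ae_absorbing hP hP1 hlam ν n D).and (ae_eventually_stable hP hP1 hlam hw hwP ν n D))
  have h2 : ∀ᵐ ω ∂(law P lam ν n D), ∀ i, 0 < ω.2 i :=
    Measure.quasiMeasurePreserving_snd.ae ae_holdingTimes_pos
  filter_upwards [h1, h2] with ω hω1 hω2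
  exact exists_endsIn hP hP1 hlam n n.ne_zero ω hω2 hω1.1 hω1.2.exists

include hP hP1 hlam hw hwP in
/-- Second moment bound in the final state, for an observable whose square has a drift that is
bounded by the rate. -/
theorem law_le_abs_finalState_le (ν : V → ℝ) (n : ℕ+) (D : V → Finset (Fin n))
    (X : State V n → ℝ) (a : ℝ) (ha : 0 ≤ a)
    (hdrift : ∀ z h, houseSum P lam n z h (fun z' => X z' ^ 2) ≤
      (X z ^ 2 + a) * houseRate lam n z h)
    (B : ℝ) (hB : ∑ arr : (x : V) → Fin ⌊ν x * n⌋₊ → Fin n,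
      X (initialState D (fun x => ⌊ν x * n⌋₊) arr) ^ 2 ≤
        Fintype.card ((x : V) → Fin ⌊ν x * n⌋₊ → Fin n) * B) (c : ℝ) (hc : 0 < c) :
    law P lam ν n D {ω | c ≤ |X (finalState P lam n ω)|} ≤
      ENNReal.ofReal ((B + a * ∑ y, 2 * w y * ((D y).card + ⌊ν y * n⌋₊)) / c ^ 2) := by
  -- The square gains at most `a` per transition in mean, and the energy loses at least 1, so `f` is
  -- a supermartingale.
  set f : State V n → ℝ := fun z => X z ^ 2 + a * z.energy w with hf
  have hf0 : ∀ z, 0 ≤ f z := fun z => by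
    have := State.energy_nonneg w hw z
    positivity
  set F : State V n → ℝ≥0∞ := fun z => ENNReal.ofReal (f z) with hF
  have hsuper : ∀ z, ∫⁻ z', F z' ∂(nextLaw P lam n z) ≤ F z := by
    intro z
    by_cases hz : z.config.Stable
    · rw [nextLaw_of_stable hP hP1 hlam n n.ne_zero z hz, lintegral_dirac]
    · have := lintegral_nextLaw_add_le hP hP1 hlam n n.ne_zero z f hf0 0 le_rfl ?_ hz
      · simpa using this
      · intro h
        have h1 := houseSum_energy_le (lam := lam) hP hP1 w hwP n n.ne_zero z h
        have h2 := hdrift z h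
        simp only [hf]
        rw [houseSum_add P lam n z h (fun z' => X z' ^ 2), houseSum_const_mul]
        have h3 := mul_le_mul_of_nonneg_left h1 ha
        linarith
  have hinit : ∫⁻ z, F z ∂(initialLaw ν n D) ≤
      ENNReal.ofReal (B + a * ∑ y, 2 * w y * ((D y).card + ⌊ν y * n⌋₊)) := by
    refine lintegral_initialLaw_le ν n D f hf0 _ ?_
    simp only [hf]
    rw [Finset.sum_add_distrib, mul_add]
    refine add_le_add hB ?_
    rw [← Finset.mul_sum, mul_left_comm]
    refine mul_le_mul_of_nonneg_left ?_ ha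
    refine (Finset.sum_le_sum fun arr _ => energy_initialState_le w D _ arr).trans_eq ?_
    rw [Finset.sum_const, Finset.card_univ, nsmul_eq_mul]
  -- `G` is measurable and almost surely equals `F` at the final state, so measurability of
  -- `finalState` is never needed.
  set G : (ℕ → State V n) → ℝ≥0∞ := fun p => liminf (fun k => F (p k)) atTop with hG
  have hGm : Measurable G :=
    Measurable.liminf fun k => (measurable_from_top (f := F)).comp (measurable_pi_apply k)
  have hGint : ∫⁻ ω, G ω.1 ∂(law P lam ν n D) ≤
      ENNReal.ofReal (B + a * ∑ y, 2 * w y * ((D y).card + ⌊ν y * n⌋₊)) := by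
    have h1 : ∫⁻ ω, G ω.1 ∂(law P lam ν n D) = ∫⁻ p, G p ∂(chainLaw P lam ν n D) :=
      (measurePreserving_fst (μ := chainLaw P lam ν n D)
        (ν := Measure.infinitePi fun _ : ℕ => expMeasure 1)).lintegral_comp hGm
    rw [h1]
    exact (lintegral_liminf_chainLaw_le P lam ν n D F hsuper).trans hinit
  have hc2 : 0 < c ^ 2 := by positivity
  have hsub : {ω | c ≤ |X (finalState P lam n ω)|} ≤ᵐ[law P lam ν n D]
      {ω | ENNReal.ofReal (c ^ 2) ≤ G ω.1} := by
    filter_upwards [ae_law_exists_endsIn hP hP1 hlam hw hwP ν n D] with ω hω hmem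
    obtain ⟨z, -, hz, hev⟩ := hω
    have hmem' : c ≤ |X (finalState P lam n ω)| := hmem
    rw [finalState_eq hz] at hmem'
    have hGz : G ω.1 = F z := by
      have : Tendsto (fun k => F (ω.1 k)) atTop (𝓝 (F z)) :=
        tendsto_const_nhds.congr' (hev.mono fun k hk => by simp only [hk])
      exact this.liminf_eq
    change ENNReal.ofReal (c ^ 2) ≤ G ω.1
    rw [hGz]
    refine ENNReal.ofReal_le_ofReal ?_
    have h1 : c ^ 2 ≤ X z ^ 2 := by
      rw [← sq_abs (X z)]
      gcongr
    have h2 := mul_nonneg ha (State.energy_nonneg w hw z)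
    simp only [hf]
    linarith
  calc law P lam ν n D {ω | c ≤ |X (finalState P lam n ω)|}
      ≤ law P lam ν n D {ω | ENNReal.ofReal (c ^ 2) ≤ G ω.1} := measure_mono_ae hsub
    _ ≤ (∫⁻ ω, G ω.1 ∂(law P lam ν n D)) / ENNReal.ofReal (c ^ 2) :=
        meas_ge_le_lintegral_div (hGm.comp measurable_fst).aemeasurable
          (by simpa using hc.ne') ENNReal.ofReal_ne_top
    _ ≤ ENNReal.ofReal (B + a * ∑ y, 2 * w y * ((D y).card + ⌊ν y * n⌋₊)) /
          ENNReal.ofReal (c ^ 2) := by gcongr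
    _ = _ := (ENNReal.ofReal_div_of_pos hc2).symm

end Final

/-! ### The limiting equations -/

section Weight

variable {V : Type*} [Fintype V] [DecidableEq V] {P : Matrix V V ℝ}

/-- The expected lifetime of a killed irreducible chain on a finite set is finite. -/
theorem exists_weight (hP : ∀ x y, 0 ≤ P x y) (hP1 : ∀ x, ∑ y, P x y ≤ 1)
    (hstrict : ∃ x, ∑ y, P x y < 1) (hirr : ∀ x y, ∃ l : ℕ, 0 < (P ^ l) x y) :
    ∃ w : V → ℝ, (∀ x, 1 ≤ w x) ∧ ∀ x, 1 + ∑ y, P x y * w y ≤ w x := by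
  obtain ⟨x₀, hx₀⟩ := hstrict
  have : Nonempty V := ⟨x₀⟩
  have hpow : ∀ k x y, 0 ≤ (P ^ k) x y := by
    intro k
    induction k with
    | zero =>
      intro x y
      rw [pow_zero, Matrix.one_apply]
      split_ifs <;> simp
    | succ k ih =>
      intro x y
      rw [pow_succ, Matrix.mul_apply]
      exact Finset.sum_nonneg fun z _ => mul_nonneg (ih x z) (hP z y)
  -- Probability that the killed chain started at `x` survives `k` steps.
  set q : ℕ → V → ℝ := fun k x => ∑ y, (P ^ k) x y with hq
  have hq0 : ∀ x, q 0 x = 1 := fun x => by simp [hq, Matrix.one_apply]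
  have hqs : ∀ k x, q (k + 1) x = ∑ y, P x y * q k y := by
    intro k x
    simp only [hq, pow_succ', Matrix.mul_apply, Finset.mul_sum]
    rw [Finset.sum_comm]
  have hqs' : ∀ k x, q (k + 1) x = ∑ y, (P ^ k) x y * ∑ z, P y z := by
    intro k x
    simp only [hq, pow_succ, Matrix.mul_apply, Finset.mul_sum]
    rw [Finset.sum_comm]
  have hqnn : ∀ k x, 0 ≤ q k x := fun k x => Finset.sum_nonneg fun y _ => hpow k x y
  have hanti : ∀ x, Antitone fun k => q k x := by
    intro x
    refine antitone_nat_of_succ_le fun k => ?_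
    rw [hqs']
    exact Finset.sum_le_sum fun y _ => mul_le_of_le_one_right (hpow k x y) (hP1 y)
  have hlt : ∀ x, ∃ k, q k x < 1 := by
    intro x
    obtain ⟨l, hl⟩ := hirr x x₀
    refine ⟨l + 1, ?_⟩
    calc q (l + 1) x = ∑ y, (P ^ l) x y * ∑ z, P y z := hqs' l x
      _ < ∑ y, (P ^ l) x y :=
          Finset.sum_lt_sum (fun y _ => mul_le_of_le_one_right (hpow l x y) (hP1 y))
            ⟨x₀, Finset.mem_univ _, mul_lt_of_lt_one_right hl hx₀⟩
      _ ≤ q 0 x := hanti x (Nat.zero_le l)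
      _ = 1 := hq0 x
  choose k hk using hlt
  set L := Finset.univ.sup k
  have hL : ∀ x, q L x < 1 := fun x =>
    (hanti x (Finset.le_sup (Finset.mem_univ x))).trans_lt (hk x)
  obtain ⟨x₁, hx₁⟩ := Finite.exists_max (q L)
  set ε := 1 - q L x₁ with hε
  have hε0 : 0 < ε := sub_pos.2 (hL x₁)
  -- Mean lifetime truncated at `L`. Telescoping gives `w - P w = (1 - q L) / ε`, and `ε` is the
  -- minimum of `1 - q L`.
  set w : V → ℝ := fun x => (∑ k ∈ Finset.range L, q k x) / ε with hw
  have hw0 : ∀ x, 0 ≤ w x := fun x =>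
    div_nonneg (Finset.sum_nonneg fun k _ => hqnn k x) hε0.le
  have hwP : ∀ x, 1 + ∑ y, P x y * w y ≤ w x := by
    intro x
    have h1 : ∑ y, P x y * w y = (∑ k ∈ Finset.range L, q (k + 1) x) / ε := by
      simp only [hw, hqs, mul_div_assoc', ← Finset.sum_div, Finset.mul_sum]
      rw [Finset.sum_comm]
    have h2 : w x - ∑ y, P x y * w y = (1 - q L x) / ε := by
      rw [h1, hw, ← sub_div, ← Finset.sum_sub_distrib, Finset.sum_range_sub', hq0]
    have h3 : 1 ≤ (1 - q L x) / ε := by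
      rw [le_div_iff₀ hε0]
      linarith [hx₁ x]
    linarith
  refine ⟨w, fun x => ?_, hwP⟩
  have : 0 ≤ ∑ y, P x y * w y := Finset.sum_nonneg fun y _ => mul_nonneg (hP x y) (hw0 y)
  linarith [hwP x]

variable {w : V → ℝ}

omit [DecidableEq V] in
-- Duality: `P` is moved from `d` onto `w`, where `P w ≤ w - 1`. This is the source of every
-- contraction below.
theorem sum_mul_weight_le (hw : ∀ x, 1 ≤ w x) (hwP : ∀ x, 1 + ∑ y, P x y * w y ≤ w x)
    {d b : V → ℝ} (hd : ∀ x, 0 ≤ d x) (hle : ∀ x, b x ≤ ∑ y, d y * P y x) :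
    ∑ x, b x * w x ≤ ∑ x, d x * w x - ∑ x, d x := by
  calc ∑ x, b x * w x ≤ ∑ x, (∑ y, d y * P y x) * w x :=
        Finset.sum_le_sum fun x _ => mul_le_mul_of_nonneg_right (hle x) (zero_le_one.trans (hw x))
    _ = ∑ y, d y * ∑ x, P y x * w x := by
        simp only [Finset.sum_mul, Finset.mul_sum]
        rw [Finset.sum_comm]
        exact Finset.sum_congr rfl fun _ _ => Finset.sum_congr rfl fun _ _ => by ring
    _ ≤ ∑ y, d y * (w y - 1) :=
        Finset.sum_le_sum fun y _ => mul_le_mul_of_nonneg_left (by linarith [hwP y]) (hd y)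
    _ = _ := by
        rw [← Finset.sum_sub_distrib]
        exact Finset.sum_congr rfl fun _ _ => by ring

omit [DecidableEq V] in
-- Apply the duality to `b = d - δ`; the weighted sums of `d` cancel.
theorem sum_le_of_le_add (hw : ∀ x, 1 ≤ w x) (hwP : ∀ x, 1 + ∑ y, P x y * w y ≤ w x)
    {d : V → ℝ} {δ : ℝ} (hd : ∀ x, 0 ≤ d x) (hle : ∀ x, d x ≤ ∑ y, d y * P y x + δ) :
    ∑ x, d x ≤ δ * ∑ x, w x := by
  have h := sum_mul_weight_le hw hwP (b := fun x => d x - δ) hd fun x => by linarith [hle x]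
  simp only [sub_mul, Finset.sum_sub_distrib, ← Finset.mul_sum] at h
  linarith

end Weight

/-! ### The fixed-point problem: existence, stability and uniqueness -/

section Flow

/-- The fraction of occupied houses after `u` arrivals per house. -/
noncomputable def occFlow (s r u : ℝ) : ℝ :=
  s * Real.exp (-u) + r * (1 - Real.exp (-u))

theorem exp_neg_sub_mem {u v : ℝ} (hu : 0 ≤ u) (huv : u ≤ v) :
    0 ≤ Real.exp (-u) - Real.exp (-v) ∧ Real.exp (-u) - Real.exp (-v) ≤ v - u := by
  have h1 : Real.exp (-v) ≤ Real.exp (-u) := Real.exp_le_exp.2 (by linarith)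
  have h2 : Real.exp (-u) ≤ 1 := Real.exp_le_one_iff.2 (by linarith)
  have h3 := Real.add_one_le_exp (-(v - u))
  have h4 : Real.exp (-v) = Real.exp (-u) * Real.exp (-(v - u)) := by
    rw [← Real.exp_add]
    ring_nf
  have h5 := Real.exp_pos (-u)
  refine ⟨by linarith, ?_⟩
  rw [h4]
  nlinarith

/-- The slope `(r - s) * exp (-u)` lies in `[0, 1]`. The hypothesis `σ ≤ λ / (1 + λ)` enters here as
`s ≤ r`; without it the slope would be negative. -/
theorem occFlow_sub_mem {s r u v : ℝ} (hsr : s ≤ r) (hsr1 : r - s ≤ 1) (hu : 0 ≤ u)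
    (huv : u ≤ v) : 0 ≤ occFlow s r v - occFlow s r u ∧ occFlow s r v - occFlow s r u ≤ v - u := by
  have h := exp_neg_sub_mem hu huv
  have h1 : occFlow s r v - occFlow s r u = (r - s) * (Real.exp (-u) - Real.exp (-v)) := by
    unfold occFlow
    ring
  rw [h1]
  constructor
  · exact mul_nonneg (by linarith) h.1
  · nlinarith

theorem abs_occFlow_sub_le {s r u v : ℝ} (hsr : s ≤ r) (hsr1 : r - s ≤ 1) (hu : 0 ≤ u)
    (hv : 0 ≤ v) : |occFlow s r u - occFlow s r v| ≤ |u - v| ∧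
      |(u - occFlow s r u) - (v - occFlow s r v)| ≤ |u - v| := by
  rcases le_total u v with h | h
  · have := occFlow_sub_mem hsr hsr1 hu h
    rw [abs_sub_comm u v, abs_of_nonneg (sub_nonneg.2 h), abs_le, abs_le]
    constructor <;> constructor <;> linarith
  · have := occFlow_sub_mem hsr hsr1 hv h
    rw [abs_of_nonneg (sub_nonneg.2 h), abs_le, abs_le]
    constructor <;> constructor <;> linarith

variable {V : Type*} [Fintype V] [DecidableEq V] {P : Matrix V V ℝ} {lam σ ν w : V → ℝ}

theorem ratio_mem {l : ℝ} (hl : 0 ≤ l) : 0 ≤ l / (1 + l) ∧ l / (1 + l) < 1 := by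
  refine ⟨by positivity, ?_⟩
  rw [div_lt_one (by linarith)]
  linarith

omit [DecidableEq V] in
theorem abs_sum_mul_sub_le (hP : ∀ x y, 0 ≤ P x y) (m m' : V → ℝ) (x : V) :
    |∑ y, m y * P y x - ∑ y, m' y * P y x| ≤ ∑ y, |m y - m' y| * P y x := by
  rw [← Finset.sum_sub_distrib]
  refine (Finset.abs_sum_le_sum_abs _ _).trans_eq (Finset.sum_congr rfl fun y _ => ?_)
  rw [← sub_mul, abs_mul, abs_of_nonneg (hP y x)]

omit [DecidableEq V] in
-- With `s` eliminated, `m` is a fixed point of `T`. Increments of `T` are dominated by the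
-- transpose of `P`, so the iterates from 0 are Cauchy, at a geometric rate in the `w`-weighted ℓ¹
-- norm.
theorem exists_isSolution (hP : ∀ x y, 0 ≤ P x y) (hlam : ∀ x, 0 ≤ lam x)
    (hσ : ∀ x, σ x ∈ Set.Icc (0 : ℝ) 1) (hν : ∀ x, 0 ≤ ν x)
    (hsub : ∀ x, σ x ≤ lam x / (1 + lam x))
    (hw : ∀ x, 1 ≤ w x) (hwP : ∀ x, 1 + ∑ y, P x y * w y ≤ w x) :
    ∃ s m, IsSolution P lam σ ν s m := by
  set r : V → ℝ := fun x => lam x / (1 + lam x) with hr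
  have hr1 : ∀ x, r x - σ x ≤ 1 := fun x => by linarith [(ratio_mem (hlam x)).2, (hσ x).1]
  set u : (V → ℝ) → V → ℝ := fun m x => ν x + ∑ y, m y * P y x with hu
  set T : (V → ℝ) → V → ℝ := fun m x => u m x + σ x - occFlow (σ x) (r x) (u m x) with hT
  have hu0 : ∀ m : V → ℝ, (∀ x, 0 ≤ m x) → ∀ x, 0 ≤ u m x := fun m hm x =>
    add_nonneg (hν x) (Finset.sum_nonneg fun y _ => mul_nonneg (hm y) (hP y x))
  have hT0 : ∀ m : V → ℝ, (∀ x, 0 ≤ m x) → ∀ x, 0 ≤ T m x := by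
    intro m hm x
    have h1 := (occFlow_sub_mem (hsub x) (hr1 x) le_rfl (hu0 m hm x)).2
    have h2 : occFlow (σ x) (r x) 0 = σ x := by simp [occFlow]
    simp only [hT]
    linarith
  have hTl : ∀ m m' : V → ℝ, (∀ x, 0 ≤ m x) → (∀ x, 0 ≤ m' x) → ∀ x,
      |T m x - T m' x| ≤ ∑ y, |m y - m' y| * P y x := by
    intro m m' hm hm' x
    have h1 := (abs_occFlow_sub_le (hsub x) (hr1 x) (hu0 m hm x) (hu0 m' hm' x)).2
    have h2 := abs_sum_mul_sub_le hP m m' x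
    have h3 : T m x - T m' x = (u m x - occFlow (σ x) (r x) (u m x)) -
        (u m' x - occFlow (σ x) (r x) (u m' x)) := by
      simp only [hT]
      ring
    have h4 : u m x - u m' x = ∑ y, m y * P y x - ∑ y, m' y * P y x := by
      simp only [hu]
      ring
    rw [h3]
    exact h1.trans (h4 ▸ h2)
  set M : ℕ → V → ℝ := fun k => T^[k] 0 with hM
  have hMs : ∀ k, M (k + 1) = T (M k) := fun k => Function.iterate_succ_apply' T k 0
  have hM0 : ∀ k x, 0 ≤ M k x := by
    intro k
    induction k with
    | zero => exact fun x => le_rfl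
    | succ k ih =>
      rw [hMs]
      exact hT0 _ ih
  -- As `w ≤ W`, the gain `∑ d` in `sum_mul_weight_le` is at least `1 / W` of the weighted norm. The
  -- `+ 1` ensures `W ≥ 1` even for empty `V`.
  set W := ∑ x, w x + 1 with hW
  have hw0 : ∀ x, 0 ≤ w x := fun x => zero_le_one.trans (hw x)
  have hwW : ∀ x, w x ≤ W := fun x => by
    have := Finset.single_le_sum (fun y _ => hw0 y) (Finset.mem_univ x)
    linarith
  have hW1 : 1 ≤ W := by linarith [Finset.sum_nonneg fun x (_ : x ∈ Finset.univ) => hw0 x]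
  have hW0 : 0 < W := by linarith
  have hgeom : ∀ k, ∑ x, |M (k + 1) x - M k x| * w x ≤
      (∑ x, |M 1 x - M 0 x| * w x) * (1 - 1 / W) ^ k := by
    intro k
    induction k with
    | zero => simp
    | succ k ih =>
      have h1 := sum_mul_weight_le hw hwP (b := fun x => |M (k + 1 + 1) x - M (k + 1) x|)
        (d := fun x => |M (k + 1) x - M k x|) (fun x => abs_nonneg _) fun x => by
          rw [hMs (k + 1), hMs k]
          have := hTl (M (k + 1)) (M k) (hM0 _) (hM0 _) x
          rw [hMs k] at this
          exact this
      have h2 : (1 / W) * ∑ x, |M (k + 1) x - M k x| * w x ≤ ∑ x, |M (k + 1) x - M k x| := by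
        rw [Finset.mul_sum]
        refine Finset.sum_le_sum fun x _ => ?_
        rw [one_div, inv_mul_le_iff₀ hW0, mul_comm]
        exact mul_le_mul_of_nonneg_right (hwW x) (abs_nonneg _)
      have h3 : 0 ≤ 1 - 1 / W := by
        rw [sub_nonneg, div_le_one hW0]
        exact hW1
      calc _ ≤ (1 - 1 / W) * ∑ x, |M (k + 1) x - M k x| * w x := by linarith
        _ ≤ (1 - 1 / W) * ((∑ x, |M 1 x - M 0 x| * w x) * (1 - 1 / W) ^ k) := by gcongr
        _ = _ := by ring
  have hcauchy : CauchySeq M := by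
    refine cauchySeq_of_le_geometric (1 - 1 / W) (∑ x, |M 1 x - M 0 x| * w x)
      (by linarith [one_div_pos.2 hW0]) fun k => ?_
    refine le_trans ?_ (hgeom k)
    rw [dist_comm, dist_pi_le_iff
      (Finset.sum_nonneg fun x _ => mul_nonneg (abs_nonneg _) (hw0 x))]
    intro x
    rw [Real.dist_eq]
    calc |M (k + 1) x - M k x| ≤ |M (k + 1) x - M k x| * w x :=
          le_mul_of_one_le_right (abs_nonneg _) (hw x)
      _ ≤ _ := Finset.single_le_sum (f := fun x => |M (k + 1) x - M k x| * w x)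
          (fun y _ => mul_nonneg (abs_nonneg _) (hw0 y)) (Finset.mem_univ x)
  obtain ⟨m, hm⟩ := cauchySeq_tendsto_of_complete hcauchy
  have hm0 : ∀ x, 0 ≤ m x := fun x =>
    ge_of_tendsto' ((continuous_apply x).tendsto m |>.comp hm) fun k => hM0 k x
  have hTc : Continuous T := by
    refine continuous_pi fun x => ?_
    simp only [hT, hu, occFlow]
    fun_prop
  have hfix : T m = m := by
    refine tendsto_nhds_unique ((hTc.tendsto m).comp hm) ?_
    have := (tendsto_add_atTop_iff_nat 1).2 hm
    exact this.congr hMs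
  refine ⟨fun x => occFlow (σ x) (r x) (u m x), m, ⟨fun x => ?_, hm0, fun x => ?_, fun x => rfl⟩⟩
  · have h1 := (occFlow_sub_mem (hsub x) (hr1 x) le_rfl (hu0 m hm0 x)).1
    have h2 : occFlow (σ x) (r x) 0 = σ x := by simp [occFlow]
    have h3 := (ratio_mem (hlam x)).2
    have h4 : occFlow (σ x) (r x) (u m x) ≤ r x := by
      have := mul_nonneg (sub_nonneg.2 (hsub x)) (Real.exp_pos (-(u m x))).le
      unfold occFlow
      simp only [hr] at *
      linarith
    constructor
    · linarith [(hσ x).1]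
    · simp only [hr] at *
      linarith
  · have h1 : m x = T m x := by rw [hfix]
    simp only [hT, hu] at h1
    simp only [hu]
    linarith

omit [DecidableEq V] in
/-- Approximate solutions of the limiting equations are close to any exact solution. -/
theorem IsSolution.abs_sub_le_of_approx (hP : ∀ x y, 0 ≤ P x y) (hP1 : ∀ x, ∑ y, P x y ≤ 1)
    (hlam : ∀ x, 0 ≤ lam x) (hσ : ∀ x, σ x ∈ Set.Icc (0 : ℝ) 1) (hν : ∀ x, 0 ≤ ν x)
    (hsub : ∀ x, σ x ≤ lam x / (1 + lam x))
    (hw : ∀ x, 1 ≤ w x) (hwP : ∀ x, 1 + ∑ y, P x y * w y ≤ w x)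
    {s m s' m' d N : V → ℝ} (hsol : IsSolution P lam σ ν s m) {δ : ℝ} (hδ : δ ≤ 1 / 4)
    (hm' : ∀ x, 0 ≤ m' x) (hd : ∀ x, d x ∈ Set.Icc (0 : ℝ) 1) (hdσ : ∀ x, |d x - σ x| ≤ δ)
    (hNν : ∀ x, |N x - ν x| ≤ δ)
    (hbal : ∀ x, |s' x + m' x - ∑ y, m' y * P y x - (d x + N x)| ≤ δ)
    (hexit : ∀ x, |s' x - lam x / (1 + lam x) -
      (d x - lam x / (1 + lam x)) * Real.exp (-(s' x + m' x - d x))| ≤ δ) (x : V) :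
    |s' x - s x| ≤ (9 * ∑ y, w y + 6) * δ ∧ |m' x - m x| ≤ (9 * ∑ y, w y + 6) * δ := by
  set r : V → ℝ := fun x => lam x / (1 + lam x) with hr
  have hr0 : ∀ x, 0 ≤ r x ∧ r x < 1 := fun x => ratio_mem (hlam x)
  have hr1 : ∀ x, r x - σ x ≤ 1 := fun x => by linarith [(hr0 x).2, (hσ x).1]
  have hδ0 : 0 ≤ δ := (abs_nonneg _).trans (hNν x)
  set u : V → ℝ := fun x => ν x + ∑ y, m y * P y x with hu
  set u' : V → ℝ := fun x => ν x + ∑ y, m' y * P y x with hu'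
  have hu0 : ∀ x, 0 ≤ u x := fun x =>
    add_nonneg (hν x) (Finset.sum_nonneg fun y _ => mul_nonneg (hsol.m_nonneg y) (hP y x))
  have hu0' : ∀ x, 0 ≤ u' x := fun x =>
    add_nonneg (hν x) (Finset.sum_nonneg fun y _ => mul_nonneg (hm' y) (hP y x))
  have huu : ∀ x, |u' x - u x| ≤ ∑ y, |m' y - m y| * P y x := fun x => by
    have h := abs_sum_mul_sub_le hP m' m x
    have h4 : u' x - u x = ∑ y, m' y * P y x - ∑ y, m y * P y x := by
      simp only [hu, hu']
      ring
    rw [h4]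
    exact h
  have hs : ∀ x, s x = occFlow (σ x) (r x) (u x) := fun x => hsol.lastExit x
  have hm : ∀ x, m x = u x - occFlow (σ x) (r x) (u x) + σ x := fun x => by
    have h1 := hsol.balance x
    rw [← hs x]
    simp only [hu]
    linarith
  -- One `δ` from the mass balance, one from replacing `N` by `ν`.
  have hA : ∀ x, |s' x + m' x - d x - u' x| ≤ 2 * δ := fun x => by
    have h1 := abs_le.1 (hbal x)
    have h2 := abs_le.1 (hNν x)
    simp only [hu']
    rw [abs_le]
    constructor <;> linarith
  -- `6 = 1 + 4 + 1`: the last-exit error, the exponential (linear bound, allowed by `2 * δ ≤ 1`),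
  -- and replacing `d` by `σ`.
  have hs' : ∀ x, |s' x - occFlow (σ x) (r x) (u' x)| ≤ 6 * δ := fun x => by
    set A := s' x + m' x - d x with hAdef
    set e := Real.exp (-u' x) with he
    have he0 : 0 < e := Real.exp_pos _
    have he1 : e ≤ 1 := Real.exp_le_one_iff.2 (by linarith [hu0' x])
    have hAe : |Real.exp (-A) - e| ≤ 4 * δ := by
      have h1 : Real.exp (-A) - e = e * (Real.exp (-(A - u' x)) - 1) := by
        rw [mul_sub, he, ← Real.exp_add]
        ring_nf
      have h2 : |-(A - u' x)| ≤ 1 := by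
        rw [abs_neg]
        linarith [hA x]
      have h3 := Real.abs_exp_sub_one_le h2
      rw [abs_neg] at h3
      rw [h1, abs_mul, abs_of_pos he0]
      calc e * |Real.exp (-(A - u' x)) - 1| ≤ 1 * (2 * |A - u' x|) :=
            mul_le_mul he1 h3 (abs_nonneg _) zero_le_one
        _ ≤ 4 * δ := by linarith [hA x]
    have h2 : s' x - occFlow (σ x) (r x) (u' x) =
        (s' x - r x - (d x - r x) * Real.exp (-A)) + (d x - r x) * (Real.exp (-A) - e) +
          (d x - σ x) * e := by
      unfold occFlow
      ring
    have h3 : |(d x - r x) * (Real.exp (-A) - e)| ≤ 1 * (4 * δ) := by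
      rw [abs_mul]
      refine mul_le_mul ?_ hAe (abs_nonneg _) zero_le_one
      have := hr0 x
      have := hd x
      rw [abs_le]
      constructor <;> linarith [this.1, this.2]
    have h4 : |(d x - σ x) * e| ≤ δ * 1 := by
      rw [abs_mul, abs_of_pos he0]
      exact mul_le_mul (hdσ x) he1 he0.le hδ0
    rw [h2]
    have h5 := hexit x
    refine (abs_add_le _ _).trans ?_
    have h6 := abs_add_le (s' x - r x - (d x - r x) * Real.exp (-A))
      ((d x - r x) * (Real.exp (-A) - e))
    linarith
  -- `9 = 2 + 1 + 6`, from `hA`, `hdσ` and `hs'`.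
  have hmm : ∀ x, |m' x - m x| ≤ ∑ y, |m' y - m y| * P y x + 9 * δ := fun x => by
    have h1 := (abs_occFlow_sub_le (hsub x) (hr1 x) (hu0' x) (hu0 x)).2
    have h2 : m' x - m x = ((u' x - occFlow (σ x) (r x) (u' x)) -
        (u x - occFlow (σ x) (r x) (u x))) +
        ((s' x + m' x - d x - u' x) + (d x - σ x) - (s' x - occFlow (σ x) (r x) (u' x))) := by
      rw [hm x]
      ring
    have h3 := abs_le.1 (hA x)
    have h4 := abs_le.1 (hdσ x)
    have h5 := abs_le.1 (hs' x)
    have h6 := abs_le.1 (h1.trans (huu x))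
    rw [h2, abs_le]
    constructor <;> linarith
  have hsum := sum_le_of_le_add hw hwP (fun x => abs_nonneg (m' x - m x)) hmm
  have hPle : ∀ y x, P y x ≤ 1 := fun y x =>
    (Finset.single_le_sum (fun z _ => hP y z) (Finset.mem_univ x)).trans (hP1 y)
  constructor
  · have h1 := (abs_occFlow_sub_le (hsub x) (hr1 x) (hu0' x) (hu0 x)).1
    have h2 : ∑ y, |m' y - m y| * P y x ≤ ∑ y, |m' y - m y| :=
      Finset.sum_le_sum fun y _ => mul_le_of_le_one_right (abs_nonneg _) (hPle y x)
    have h3 := abs_sub_le (s' x) (occFlow (σ x) (r x) (u' x)) (s x)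
    rw [hs x] at h3 ⊢
    linarith [hs' x, huu x]
  · have h1 := Finset.single_le_sum (fun y _ => abs_nonneg (m' y - m y)) (Finset.mem_univ x)
    linarith

omit [DecidableEq V] in
-- An exact solution is an approximate one with `δ = 0`.
theorem IsSolution.unique (hP : ∀ x y, 0 ≤ P x y) (hP1 : ∀ x, ∑ y, P x y ≤ 1)
    (hlam : ∀ x, 0 ≤ lam x) (hσ : ∀ x, σ x ∈ Set.Icc (0 : ℝ) 1) (hν : ∀ x, 0 ≤ ν x)
    (hsub : ∀ x, σ x ≤ lam x / (1 + lam x))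
    (hw : ∀ x, 1 ≤ w x) (hwP : ∀ x, 1 + ∑ y, P x y * w y ≤ w x)
    {s m s' m' : V → ℝ} (hsol : IsSolution P lam σ ν s m) (hsol' : IsSolution P lam σ ν s' m') :
    s' = s ∧ m' = m := by
  have h := hsol.abs_sub_le_of_approx hP hP1 hlam hσ hν hsub hw hwP (s' := s') (m' := m') (d := σ) (N := ν)
    (δ := 0) (by norm_num) hsol'.m_nonneg hσ (by simp) (by simp)
    (fun x => by
      rw [hsol'.balance x]
      ring_nf
      simp)
    (fun x => by
      have h1 : s' x + m' x - σ x = ν x + ∑ y, m' y * P y x := by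
        rw [hsol'.balance x]
        ring
      rw [h1]
      nth_rw 1 [hsol'.lastExit x]
      ring_nf
      simp)
  simp only [mul_zero, abs_nonpos_iff, sub_eq_zero] at h
  exact ⟨funext fun x => (h x).1, funext fun x => (h x).2⟩

end Flow

/-! ### The law of large numbers -/

section Limit

theorem abs_floor_div_sub_le {a : ℝ} (ha : 0 ≤ a) (n : ℕ+) :
    |(⌊a * n⌋₊ : ℝ) / n - a| ≤ 1 / n := by
  have hn : (0 : ℝ) < n := by exact_mod_cast n.pos
  have h1 := Nat.floor_le (mul_nonneg ha hn.le)
  have h2 := Nat.lt_floor_add_one (a * n)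
  have h3 : (⌊a * n⌋₊ : ℝ) / n - a = (⌊a * n⌋₊ - a * n) / n := by field_simp
  rw [h3, abs_div, abs_of_pos hn]
  refine div_le_div_of_nonneg_right ?_ hn.le
  rw [abs_le]
  constructor <;> linarith

variable {V : Type*} [Fintype V]

/-- Number of sleepy particles in village `x`. -/
def State.numSleepy {n : ℕ} (z : State V n) (x : V) : ℕ :=
  Fintype.card {i : Fin n // z.config (x, i) = HouseState.sleepy}

omit [Fintype V] in
-- Stable houses are sleepy or empty. A general `g` covers both the particle count and the credit
-- `occ`.
theorem sum_eq_numSleepy {n : ℕ} (z : State V n) (hz : z.config.Stable) (x : V)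
    (g : HouseState → ℝ) (h1 : g .sleepy = 1) (h0 : g (.active 0) = 0) :
    ∑ i, g (z.config (x, i)) = z.numSleepy x := by
  unfold State.numSleepy
  rw [Fintype.card_subtype, Finset.card_filter]
  push_cast
  refine Finset.sum_congr rfl fun i _ => ?_
  have := hz (x, i)
  rcases hs : z.config (x, i) with _ | k
  · simp [h1]
  · simp only [hs, HouseState.numActive] at this
    simp [this, h0]

variable [DecidableEq V] {P : Matrix V V ℝ} {lam σ ν w : V → ℝ}

/-- Union bound over villages and the two observables: second moments of order `n` against the
squared threshold `(δ * n) ^ 2`. -/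
theorem law_exists_villageDev_or_flow_le (hP : ∀ x y, 0 ≤ P x y) (hP1 : ∀ x, ∑ y, P x y ≤ 1)
    (hlam : ∀ x, 0 ≤ lam x) (hν : ∀ x, 0 ≤ ν x)
    (hw : ∀ x, 1 ≤ w x) (hwP : ∀ x, 1 + ∑ y, P x y * w y ≤ w x) (n : ℕ+)
    (D : V → Finset (Fin n)) {δ : ℝ} (hδ : 0 < δ) :
    law P lam ν n D {ω | ∃ x,
      δ * n ≤ |(finalState P lam n ω).villageDev x (lam x / (1 + lam x)) (D x).card| ∨
      δ * n ≤ |(finalState P lam n ω).flow P x - ((D x).card + ⌊ν x * n⌋₊)|} ≤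
      ENNReal.ofReal ((∑ x, (40 * ν x + 2 * (60 * ∑ y, 2 * w y * (1 + ν y)))) / δ ^ 2 * (1 / n)) := by
  have hn : (0 : ℝ) < n := by exact_mod_cast n.pos
  have hc : 0 < δ * n := by positivity
  set E := ∑ y, 2 * w y * (1 + ν y) with hE
  have hw0 : ∀ x, 0 ≤ w x := fun x => zero_le_one.trans (hw x)
  have hE0 : 0 ≤ E := Finset.sum_nonneg fun y _ => by
    have := hw0 y
    have := hν y
    positivity
  have hfl : ∀ x, (⌊ν x * n⌋₊ : ℝ) ≤ ν x * n := fun x => Nat.floor_le (mul_nonneg (hν x) hn.le)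
  have hEn : ∑ y, 2 * w y * ((D y).card + ⌊ν y * n⌋₊) ≤ E * n := by
    rw [hE, Finset.sum_mul]
    refine Finset.sum_le_sum fun y _ => ?_
    have h1 : ((D y).card : ℝ) ≤ n := by
      exact_mod_cast (Finset.card_le_univ (D y)).trans_eq (Fintype.card_fin n)
    have h2 := hfl y
    have h3 := hw0 y
    rw [mul_assoc (2 * w y)]
    refine mul_le_mul_of_nonneg_left ?_ (by positivity)
    linarith
  have hX : ∀ x, law P lam ν n D {ω | δ * n ≤
      |(finalState P lam n ω).villageDev x (lam x / (1 + lam x)) (D x).card|} ≤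
      ENNReal.ofReal ((40 * ν x + 60 * E) / δ ^ 2 * (1 / n)) := by
    intro x
    have hr := ratio_mem (hlam x)
    have hd : ((D x).card : ℝ) ≤ n := by
      exact_mod_cast (Finset.card_le_univ (D x)).trans_eq (Fintype.card_fin n)
    refine (law_le_abs_finalState_le hP hP1 hlam hw hwP ν n D
      (fun z => z.villageDev x (lam x / (1 + lam x)) (D x).card) 60 (by norm_num)
      (fun z h => houseSum_villageDev_sq_le hP hP1 hlam n n.ne_zero z h x _ (Nat.cast_nonneg _) hd)
      (40 * ⌊ν x * n⌋₊) (sum_villageDev_initialState_sq_le n n.ne_zero D _ x hr.1 hr.2.le)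
      (δ * n) hc).trans (ENNReal.ofReal_le_ofReal ?_)
    have h1 : (40 * ν x + 60 * E) / δ ^ 2 * (1 / n) =
        (40 * (ν x * n) + 60 * (E * n)) / (δ * n) ^ 2 := by
      field_simp
    rw [h1]
    refine div_le_div_of_nonneg_right ?_ (by positivity)
    linarith [hfl x]
  have hQ : ∀ x, law P lam ν n D {ω | δ * n ≤
      |(finalState P lam n ω).flow P x - ((D x).card + ⌊ν x * n⌋₊)|} ≤
      ENNReal.ofReal (60 * E / δ ^ 2 * (1 / n)) := by
    intro x
    refine (law_le_abs_finalState_le hP hP1 hlam hw hwP ν n D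
      (fun z => z.flow P x - ((D x).card + ⌊ν x * n⌋₊)) 60 (by norm_num)
      (fun z h => houseSum_flow_sq_le hP hP1 hlam n n.ne_zero z h x _) 0
      (by simp [flow_initialState]) (δ * n) hc).trans (ENNReal.ofReal_le_ofReal ?_)
    have h1 : 60 * E / δ ^ 2 * (1 / n) = (0 + 60 * (E * n)) / (δ * n) ^ 2 := by
      field_simp
      ring
    rw [h1]
    refine div_le_div_of_nonneg_right ?_ (by positivity)
    linarith
  have hnn : ∀ x, 0 ≤ 40 * ν x := fun x => mul_nonneg (by norm_num) (hν x)
  have hsub : {ω | ∃ x,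
      δ * n ≤ |(finalState P lam n ω).villageDev x (lam x / (1 + lam x)) (D x).card| ∨
      δ * n ≤ |(finalState P lam n ω).flow P x - ((D x).card + ⌊ν x * n⌋₊)|} ⊆
      ⋃ x ∈ (Finset.univ : Finset V), ({ω | δ * n ≤
        |(finalState P lam n ω).villageDev x (lam x / (1 + lam x)) (D x).card|} ∪
        {ω | δ * n ≤ |(finalState P lam n ω).flow P x - ((D x).card + ⌊ν x * n⌋₊)|}) := by
    rintro ω ⟨x, hx⟩
    simp only [Set.mem_iUnion]
    exact ⟨x, Finset.mem_univ x, hx⟩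
  calc _ ≤ _ := measure_mono hsub
    _ ≤ ∑ x, law P lam ν n D ({ω | δ * n ≤
        |(finalState P lam n ω).villageDev x (lam x / (1 + lam x)) (D x).card|} ∪
        {ω | δ * n ≤ |(finalState P lam n ω).flow P x - ((D x).card + ⌊ν x * n⌋₊)|}) :=
        measure_biUnion_finset_le _ _
    _ ≤ ∑ x, ENNReal.ofReal ((40 * ν x + 2 * (60 * E)) / δ ^ 2 * (1 / n)) := by
        refine Finset.sum_le_sum fun x _ => (measure_union_le _ _).trans ?_
        refine (add_le_add (hX x) (hQ x)).trans_eq ?_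
        rw [← ENNReal.ofReal_add]
        · congr 1
          ring
        · have := hnn x
          positivity
        · positivity
    _ = _ := by
        rw [← ENNReal.ofReal_sum_of_nonneg]
        · rw [Finset.sum_div, Finset.sum_mul]
        · intro x _
          have := hnn x
          positivity

omit [DecidableEq V] in
/-- In a stable state where all deviations are small, the densities of sleepy particles and of
jumps are close to the solution of the limiting equations. -/
theorem abs_numSleepy_div_sub_le (hP : ∀ x y, 0 ≤ P x y) (hP1 : ∀ x, ∑ y, P x y ≤ 1)
    (hlam : ∀ x, 0 ≤ lam x) (hσ : ∀ x, σ x ∈ Set.Icc (0 : ℝ) 1) (hν : ∀ x, 0 ≤ ν x)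
    (hsub : ∀ x, σ x ≤ lam x / (1 + lam x))
    (hw : ∀ x, 1 ≤ w x) (hwP : ∀ x, 1 + ∑ y, P x y * w y ≤ w x)
    {s m : V → ℝ} (hsol : IsSolution P lam σ ν s m) {δ : ℝ} (hδ : δ ≤ 1 / 4) (n : ℕ+)
    (hnδ : 1 / (n : ℝ) ≤ δ) (D : V → Finset (Fin n)) (hD : ∀ x, (D x).card = ⌊σ x * n⌋₊)
    (z : State V n) (hz : z.config.Stable)
    (hX : ∀ x, |z.villageDev x (lam x / (1 + lam x)) (D x).card| ≤ δ * n)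
    (hQ : ∀ x, |z.flow P x - ((D x).card + ⌊ν x * n⌋₊)| ≤ δ * n) (x : V) :
    |(z.numSleepy x : ℝ) / n - s x| ≤ (9 * ∑ y, w y + 6) * δ ∧
      |(z.odometer x : ℝ) / n - m x| ≤ (9 * ∑ y, w y + 6) * δ := by
  have hn : (0 : ℝ) < n := by exact_mod_cast n.pos
  have hn' := hn.ne'
  have hmass : ∀ x, z.mass x = z.numSleepy x := fun x =>
    sum_eq_numSleepy z hz x (fun s => (s.total : ℝ)) (by simp [HouseState.total])
      (by simp [HouseState.total])
  have hocc : ∀ x r, ∑ i, (z.config (x, i)).occ r = z.numSleepy x := fun x r =>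
    sum_eq_numSleepy z hz x (HouseState.occ r) rfl rfl
  have hdiv : ∀ a : ℝ, |a| ≤ δ * n → |a / n| ≤ δ := fun a ha => by
    rw [abs_div, abs_of_pos hn, div_le_iff₀ hn]
    exact ha
  refine hsol.abs_sub_le_of_approx hP hP1 hlam hσ hν hsub hw hwP
    (s' := fun x => (z.numSleepy x : ℝ) / n) (m' := fun x => (z.odometer x : ℝ) / n)
    (d := fun x => ((D x).card : ℝ) / n) (N := fun x => (⌊ν x * n⌋₊ : ℝ) / n) hδ
    (fun x => by positivity) (fun x => ⟨by positivity, ?_⟩) (fun x => ?_) (fun x => ?_)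
    (fun x => ?_) (fun x => ?_) x
  · rw [div_le_one hn]
    exact_mod_cast (Finset.card_le_univ (D x)).trans_eq (Fintype.card_fin n)
  · rw [hD]
    exact (abs_floor_div_sub_le (hσ x).1 n).trans hnδ
  · exact (abs_floor_div_sub_le (hν x) n).trans hnδ
  · have h1 := hdiv _ (hQ x)
    convert h1 using 2
    unfold State.flow State.influx
    rw [hmass]
    simp only [div_mul_eq_mul_div, ← Finset.sum_div]
    ring
  · have h1 := hdiv _ (hX x)
    convert h1 using 2
    unfold State.villageDev occDev State.influx
    rw [hocc, hmass]
    have h2 : -((z.numSleepy x : ℝ) / n + (z.odometer x : ℝ) / n - ((D x).card : ℝ) / n) =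
        -((z.numSleepy x + z.odometer x - (D x).card) / n) := by ring
    rw [h2]
    field_simp

theorem tendsto_ofReal_const_mul_one_div (K : ℝ) :
    Tendsto (fun n : ℕ+ => ENNReal.ofReal (K * (1 / (n : ℕ)))) atTop (𝓝 0) := by
  have h1 : Tendsto (fun n : ℕ => ENNReal.ofReal (K * (1 / (n : ℝ)))) atTop (𝓝 0) := by
    have := (tendsto_one_div_atTop_nhds_zero_nat (𝕜 := ℝ)).const_mul K
    rw [mul_zero] at this
    simpa using ENNReal.tendsto_ofReal this
  exact h1.comp tendsto_PNat_val_atTop_atTop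

end Limit

end VARW

/-! ### The limit theorem -/

theorem theorem1 {V : Type*} [Fintype V] [DecidableEq V]
    (P : Matrix V V ℝ) (lam σ ν : V → ℝ)
    (hP_nonneg : ∀ x y, 0 ≤ P x y)
    (hP_sum : ∀ x, ∑ y, P x y ≤ 1)
    (hP_strict : ∃ x, ∑ y, P x y < 1)
    (hP_irred : ∀ x y, ∃ l : ℕ, 0 < (P ^ l) x y)
    (hlam : ∀ x, 0 ≤ lam x)
    (hσ : ∀ x, σ x ∈ Set.Icc (0 : ℝ) 1)
    (hν : ∀ x, 0 ≤ ν x)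
    (hsub : ∀ x, σ x ≤ lam x / (1 + lam x)) :
    ∃ s m : V → ℝ,
      VARW.IsSolution P lam σ ν s m ∧
      (∀ s' m' : V → ℝ, VARW.IsSolution P lam σ ν s' m' → s' = s ∧ m' = m) ∧
      ∀ D : (n : ℕ+) → V → Finset (Fin n), (∀ n x, (D n x).card = ⌊σ x * n⌋₊) →
        (∀ n : ℕ+, ∀ᵐ ω ∂(VARW.law P lam ν n (D n)), VARW.Stabilizes P lam n ω) ∧
        VARW.TendstoInProbability (fun n => VARW.law P lam ν n (D n))
          (fun n ω x => (VARW.sleepyCount P lam n ω x : ℝ) / n) s ∧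
        VARW.TendstoInProbability (fun n => VARW.law P lam ν n (D n))
          (fun n ω x => (VARW.jumpOdometer P lam n ω x : ℝ) / n) m := by
  obtain ⟨w, hw, hwP⟩ := VARW.exists_weight hP_nonneg hP_sum hP_strict hP_irred
  obtain ⟨s, m, hsol⟩ := VARW.exists_isSolution hP_nonneg hlam hσ hν hsub hw hwP
  refine ⟨s, m, hsol, fun s' m' hsol' =>
    hsol.unique hP_nonneg hP_sum hlam hσ hν hsub hw hwP hsol', fun D hD => ?_⟩
  have hend := fun n => VARW.ae_law_exists_endsIn hP_nonneg hP_sum hlam hw hwP ν n (D n)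
  have hC : 0 < 9 * ∑ y, w y + 6 := by
    have : 0 ≤ ∑ y, w y := Finset.sum_nonneg fun y _ => zero_le_one.trans (hw y)
    linarith
  -- Stated for any `f` controlled by the joint estimate, so that it serves for both the sleepers
  -- and the jumps.
  have key : ∀ ε : ℝ, 0 < ε → ∀ f : (n : ℕ+) → ((ℕ → VARW.State V n) × (ℕ → ℝ)) → V → ℝ,
      ∀ c : V → ℝ,
      (∀ (n : ℕ+) ω δ, (∀ x, |((VARW.finalState P lam n ω).numSleepy x : ℝ) / n - s x| ≤ δ ∧
        |((VARW.finalState P lam n ω).odometer x : ℝ) / n - m x| ≤ δ) → ∀ x, |f n ω x - c x| ≤ δ) →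
      Tendsto (fun n => VARW.law P lam ν n (D n) {ω | ε ≤ ‖f n ω - c‖}) atTop (𝓝 0) := by
    intro ε hε f c hf
    -- `1 / 4` is the range of the stability estimate; the factor 2 makes the resulting error
    -- strictly below `ε`.
    set δ := min (1 / 4) (ε / (2 * (9 * ∑ y, w y + 6))) with hδ
    have hδ0 : 0 < δ := lt_min (by norm_num) (by positivity)
    have hδε : (9 * ∑ y, w y + 6) * δ < ε := by
      have h1 : δ ≤ ε / (2 * (9 * ∑ y, w y + 6)) := min_le_right _ _
      rw [le_div_iff₀ (by positivity)] at h1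
      linarith
    refine tendsto_of_tendsto_of_tendsto_of_le_of_le' tendsto_const_nhds
      (VARW.tendsto_ofReal_const_mul_one_div
        ((∑ x, (40 * ν x + 2 * (60 * ∑ y, 2 * w y * (1 + ν y)))) / δ ^ 2))
      (Eventually.of_forall fun _ => zero_le) ?_
    have hlarge : ∀ᶠ n : ℕ+ in atTop, 1 / ((n : ℕ) : ℝ) ≤ δ :=
      tendsto_PNat_val_atTop_atTop.eventually
        ((tendsto_one_div_atTop_nhds_zero_nat (𝕜 := ℝ)).eventually (eventually_le_nhds hδ0))
    filter_upwards [hlarge] with n hn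
    refine le_trans (measure_mono_ae ?_)
      (VARW.law_exists_villageDev_or_flow_le hP_nonneg hP_sum hlam hν hw hwP n (D n) hδ0)
    filter_upwards [hend n] with ω hω hmem
    obtain ⟨z, hz, hzend, -⟩ := hω
    rw [← VARW.finalState_eq hzend] at hz
    by_contra hcon
    have hcon' : ∀ x, |(VARW.finalState P lam n ω).villageDev x (lam x / (1 + lam x)) (D n x).card| <
        δ * n ∧ |(VARW.finalState P lam n ω).flow P x - ((D n x).card + ⌊ν x * n⌋₊)| < δ * n := by
      intro x
      constructor
      · by_contra hx
        exact hcon ⟨x, Or.inl (not_lt.1 hx)⟩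
      · by_contra hx
        exact hcon ⟨x, Or.inr (not_lt.1 hx)⟩
    have h1 := hf n ω _ (VARW.abs_numSleepy_div_sub_le hP_nonneg hP_sum hlam hσ hν hsub hw hwP hsol
      (min_le_left _ _) n hn (D n) (hD n) _ hz (fun x => (hcon' x).1.le) fun x => (hcon' x).2.le)
    have h2 : ‖f n ω - c‖ < ε := (pi_norm_lt_iff hε).2 fun x => (h1 x).trans_lt hδε
    exact absurd hmem (not_le.2 h2)
  refine ⟨fun n => ?_, fun ε hε => ?_, fun ε hε => ?_⟩
  · filter_upwards [hend n] with ω hω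
    obtain ⟨z, hz, hzend, -⟩ := hω
    exact ⟨z, hz, hzend⟩
  · exact key ε hε _ _ fun n ω δ h x => (h x).1
  · exact key ε hε _ _ fun n ω δ h x => (h x).2
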